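/- **Setting.** Let $d\in\{1,2,3\}$, and let either (Neumann case) $\Omega\subset\mathbb R^d$ be a bounded domain with $C^2$ boundary, or (periodic case) $\Omega=(0,L)^d$ with $L>0$. Let $\dot H^1$ be $H^1(\Omega)$ in the Neumann case and the space of $L$-periodic $H^1$ functions in the periodic case. Let $A=-\Delta$ on $L^2(\Omega)$ with domain $\mathcal D(A)=\{v\in H^2(\Omega):\partial_\nu v=0\text{ on }\partial\Omega\}$ in the Neumann case, and the $L$-periodic $H^2$ functions in the periodic case. Write $\|\cdot\|$ for the norm and $(\cdot,\cdot)$ for the inner product of $L^2(\Omega)$, $m(v)=|\Omega|^{-1}\int_\Omega v\,dx$, $\bar v=v-m(v)$, $|v|_1=\|\nabla v\|$, and, for $v\in L^2(\Omega)$ with $m(v)=0$, $$|v|_{-1}=\sup\{|(v,\chi)|/|\chi|_1:\ \chi\in\dot H^1,\ |\chi|_1\neq0\}.$$ Let $\varepsilon>0$, $c_0>0$, $c_1,c_3\in\mathbb R$, $c_2:(0,\infty)\to\mathbb R$, and $2\le p<\infty$, with $p=2$ if $d=3$. Let $F:\mathbb R\to\mathbb R$ be differentiable with $F'=f$, $F(0)=0$,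 and, for all $v\in\mathbb R$ and $\eta>0$ (where $v^{2p}$ means $|v|^{2p}$), $$f(v)v\ge pc_0v^{2p}-c_1,\qquad |f(v)|\le\eta c_0v^{2p}+c_2(\eta),\qquad \tfrac12c_0v^{2p}-c_3\le F(v)\le\tfrac32c_0v^{2p}+c_3 .$$ For $\alpha\ge0$ put $C_1(\alpha)=(c_1+c_2\alpha+2c_3)|\Omega|$, where $c_2=c_2\big((p-\tfrac32)/\alpha\big)$ and the term $c_2\alpha$ is $0$ for $\alpha=0$. A *mesh* is a sequence $0=t^0<t^1<\cdots$ with $t^n\to\infty$ whose steps $k_n=t^{n+1}-t^n$ have a finite supremum $k=\sup_nk_n$. A *solution of the implicit Euler scheme* on it, starting from $u_0\in L^2(\Omega)$, is a sequence with $u^0=u_0$ and $u^{n+1}\in\mathcal D(A)$ such that, for all $n\ge0$, $$\frac{u^{n+1}-u^n}{k_n}+Aw^{n+1}=0,\qquad w^{n+1}=\varepsilon Au^{n+1}+f(u^{n+1})\in\mathcal D(A).$$ **Lemma (stability estimate in $H^{-1}$).** There is a constant $\gamma_1>0$, depending only on $\Omega$ and the type of boundary condition, with $|\bar v|_{-1}\le\gamma_1|v|_1$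 for all $v\in\dot H^1$. For every such $\gamma_1$, all data as above, all $\alpha\ge0$ and all $k>0$, the following holds. 1. For every mesh with $\sup_nk_n=k$ and every solution of the scheme with $|m(u_0)|\le\alpha$, the number $|\overline{u_0}|_{-1}$ is finite and, for all $n\ge0$, $$|\overline{u^{n+1}}|_{-1}^2\le e^{-\varepsilon t^{n+1}/(\gamma_1^2+\varepsilon k)}\,|\overline{u_0}|_{-1}^2+2C_1(\alpha)\,\frac{\gamma_1^2+\varepsilon k}{\varepsilon}\Big(1-e^{-\varepsilon t^{n+1}/(\gamma_1^2+\varepsilon k)}\Big).$$ 2. Let $\rho_{0k}=\big(2C_1(\alpha)(\gamma_1^2+\varepsilon k)/\varepsilon\big)^{1/2}$, $\rho>\rho_{0k}$ and $R\ge0$. There is a time $T=T(R,\alpha,\rho,k)$, which does not depend on the mesh or on $u_0$, such that every mesh with $\sup_nk_n=k$ has a positive integer $n_{0k}$, at most the first positive index $i$ with $t^i\ge T$, for which every solution with $|m(u_0)|\le\alpha$ and $|\overline{u_0}|_{-1}\le R$ satisfies $|\overline{u^n}|_{-1}\le\rho$ for all $n\ge n_{0k}$. -/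

import Mathlib

open MeasureTheory Filter Topology
open scoped ContDiff

noncomputable section

namespace CahnHilliard

/-- The Euclidean space `ℝ^d`. -/
abbrev E (d : ℕ) : Type := EuclideanSpace ℝ (Fin d)

/-- The two boundary conditions: homogeneous Neumann (flux) conditions, and periodicity with
period `L` in every coordinate direction. -/
inductive BoundaryCondition : Type
  | neumann : BoundaryCondition
  | periodic (L : ℝ) : BoundaryCondition

variable {d : ℕ}

/-- The boundary of `Ω` is of class `C²` and `Ω` lies locally on one side of it: near every
boundary point, `Ω` is the sublevel set `{r < 0}` of a `C²` function with nonzero differential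
at that point. -/
def HasC2Boundary (Ω : Set (E d)) : Prop :=
  ∀ x ∈ frontier Ω, ∃ U ∈ 𝓝 x, ∃ r : E d → ℝ,
    ContDiff ℝ 2 r ∧ fderiv ℝ r x ≠ 0 ∧ Ω ∩ U = {y | r y < 0} ∩ U

/-- The domains that go with a boundary condition: bounded domains with `C²` boundary in the
Neumann case, the cube `(0, L)^d` in the periodic case. -/
def BoundaryCondition.IsDomain : BoundaryCondition → Set (E d) → Prop
  | .neumann, Ω => IsOpen Ω ∧ IsConnected Ω ∧ Bornology.IsBounded Ω ∧ HasC2Boundary Ω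
  | .periodic L, Ω => 0 < L ∧ Ω = {x | ∀ i, 0 < x i ∧ x i < L}

/-- `v ∈ H¹(Ω)` with weak gradient `G`. -/
structure IsWeakGradient (Ω : Set (E d)) (v : E d → ℝ) (G : E d → E d) : Prop where
  memLp : MemLp v 2 (volume.restrict Ω)
  memLp_grad : MemLp G 2 (volume.restrict Ω)
  integral_eq : ∀ φ : E d → ℝ, ContDiff ℝ ∞ φ → HasCompactSupport φ → tsupport φ ⊆ Ω → ∀ i,
    ∫ x in Ω, v x * fderiv ℝ φ x (EuclideanSpace.single i 1) = -∫ x in Ω, G x i * φ x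

/-- `v` lies in the space `Ḣ¹ = D(A^{1/2})` of the boundary condition and `∇v = G`. In the Neumann
case the space is `H¹(Ω)`. In the periodic case it is the subspace of periodic functions: no
boundary term appears when integrating by parts against a smooth periodic function. -/
def BoundaryCondition.HasGradient :
    BoundaryCondition → Set (E d) → (E d → ℝ) → (E d → E d) → Prop
  | .neumann, Ω, v, G => IsWeakGradient Ω v G
  | .periodic L, Ω, v, G => IsWeakGradient Ω v G ∧
      ∀ φ : E d → ℝ, ContDiff ℝ ∞ φ →
        (∀ x i, φ (x + L • EuclideanSpace.single i 1) = φ x) → ∀ i,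
          ∫ x in Ω, v x * fderiv ℝ φ x (EuclideanSpace.single i 1) = -∫ x in Ω, G x i * φ x

/-- `v ∈ D(A)` and `A v = g`, where `A = -Δ` under the boundary condition: `v ∈ H²(Ω) ∩ Ḣ¹`,
`g = -Δ v`, and Green's formula against elements of `Ḣ¹` has no boundary term. The latter says
that the normal derivative vanishes on the boundary in the Neumann case, and that it is periodic
in the periodic case. -/
def BoundaryCondition.IsNegLaplacian (bc : BoundaryCondition) (Ω : Set (E d))
    (v g : E d → ℝ) : Prop :=
  ∃ (G : E d → E d) (H : Fin d → E d → E d),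
    bc.HasGradient Ω v G ∧
    (∀ i, IsWeakGradient Ω (fun x => G x i) (H i)) ∧
    (g =ᵐ[volume.restrict Ω] fun x => -∑ i, H i x i) ∧
    ∀ (φ : E d → ℝ) (Φ : E d → E d), bc.HasGradient Ω φ Φ →
      ∫ x in Ω, inner ℝ (G x) (Φ x) = ∫ x in Ω, g x * φ x

/-- The dual norm `|v|₋₁ = sup { |(v, χ)| / |χ|₁ : χ ∈ Ḣ¹ }`, where `|χ|₁ = ‖∇χ‖`, with values
in `[0, ∞]`. Here `0 / 0 = 0` and `a / 0 = ∞` for `a ≠ 0`, so constants `χ` contribute nothing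
if `v` has mean zero. -/
def BoundaryCondition.negNorm (bc : BoundaryCondition) (Ω : Set (E d)) (v : E d → ℝ) : ENNReal :=
  ⨆ (χ : E d → ℝ) (X : E d → E d) (_ : bc.HasGradient Ω χ X),
    ENNReal.ofReal |∫ x in Ω, v x * χ x| / eLpNorm X 2 (volume.restrict Ω)

/-- The average `m(v)` over `Ω`. -/
def mean (Ω : Set (E d)) (v : E d → ℝ) : ℝ := (∫ x in Ω, v x) / volume.real Ω

/-- `v - m(v)`. -/
def fluct (Ω : Set (E d)) (v : E d → ℝ) : E d → ℝ := fun x => v x - mean Ω v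

/-- `γ₁` is a positive constant with `|v - m(v)|₋₁ ≤ γ₁ |v|₁` for all `v`. -/
def BoundaryCondition.IsGamma (bc : BoundaryCondition) (Ω : Set (E d)) (γ₁ : ℝ) : Prop :=
  0 < γ₁ ∧ ∀ (v : E d → ℝ) (G : E d → E d), bc.HasGradient Ω v G →
    bc.negNorm Ω (fluct Ω v) ≤ ENNReal.ofReal γ₁ * eLpNorm G 2 (volume.restrict Ω)

/-- The structural assumptions on `f` and its primitive `F`, with exponent `p` and constants
`c₀, c₁, c₂(η), c₃`; `v^{2p}` means `|v|^{2p}`. -/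
structure Nonlinearity (d : ℕ) (f F : ℝ → ℝ) (p c₀ c₁ : ℝ) (c₂ : ℝ → ℝ) (c₃ : ℝ) : Prop where
  two_le : 2 ≤ p
  eq_two : d = 3 → p = 2
  c₀_pos : 0 < c₀
  coercive : ∀ v, p * c₀ * |v| ^ (2 * p) - c₁ ≤ f v * v
  growth : ∀ η, 0 < η → ∀ v, |f v| ≤ η * c₀ * |v| ^ (2 * p) + c₂ η
  primitive : ∀ v, HasDerivAt F (f v) v
  primitive_zero : F 0 = 0
  lower : ∀ v, 1 / 2 * c₀ * |v| ^ (2 * p) - c₃ ≤ F v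
  upper : ∀ v, F v ≤ 3 / 2 * c₀ * |v| ^ (2 * p) + c₃

/-- `C₁(α) = (c₁ + c₂ α + 2 c₃) |Ω|`, where `c₂ = c₂(η)` with `η = (p - 3/2) / α`. For `α = 0`
the middle term is zero. -/
def C1 (Ω : Set (E d)) (p c₁ : ℝ) (c₂ : ℝ → ℝ) (c₃ α : ℝ) : ℝ :=
  (c₁ + c₂ ((p - 3 / 2) / α) * α + 2 * c₃) * volume.real Ω

/-- `0 = t⁰ < t¹ < ⋯` is a partition of `[0, ∞)` whose steps have supremum `k`. -/
structure IsMesh (t : ℕ → ℝ) (k : ℝ) : Prop where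
  zero : t 0 = 0
  strictMono : StrictMono t
  tendsto : Tendsto t atTop atTop
  isLUB : IsLUB (Set.range fun n => t (n + 1) - t n) k

/-- `u⁰, u¹, …` solves the implicit Euler scheme on the mesh `t`: `u⁰ ∈ L²(Ω)` and, for all `n`,
`(uⁿ⁺¹ - uⁿ) / kₙ + A w = 0` with `w = ε A uⁿ⁺¹ + f(uⁿ⁺¹)`, where `uⁿ⁺¹, w ∈ D(A)`. -/
def BoundaryCondition.IsEulerSolution (bc : BoundaryCondition) (Ω : Set (E d)) (ε : ℝ)
    (f : ℝ → ℝ) (t : ℕ → ℝ) (u : ℕ → E d → ℝ) : Prop :=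
  MemLp (u 0) 2 (volume.restrict Ω) ∧
  ∀ n, ∃ Au w Aw : E d → ℝ,
    bc.IsNegLaplacian Ω (u (n + 1)) Au ∧
    (w =ᵐ[volume.restrict Ω] fun x => ε * Au x + f (u (n + 1) x)) ∧
    bc.IsNegLaplacian Ω w Aw ∧
    ∀ᵐ x ∂(volume.restrict Ω), (u (n + 1) x - u n x) / (t (n + 1) - t n) + Aw x = 0

end CahnHilliard

end

/-!
Write `|v|₁ = ‖∇v‖`. The square of the dual norm is a Legendre transform,
`|g|₋₁² = sup_χ (2 (g, χ) - |χ|₁²)`. If `g' = g - κ A w`, then bounding the supremum for `g` from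
below by its value at `χ + κ w` gives `|g'|₋₁² + 2 κ (g', w) ≤ |g|₋₁²`. For a step of the scheme the
average is conserved, so this applies to `g = u - m(u)` and `g' = u' - m(u')`. Moreover
`(g', w) = ε |u'|₁² + (g', f(u'))`, and the last term is bounded below by a constant, because
`(v - m) f(v)` is. Since `|g'|₋₁ ≤ γ₁ |u'|₁`, the step contracts `|·|₋₁²` up to an additive
constant, and a discrete Gronwall inequality gives both estimates.

The constant `γ₁` comes from the Poincaré inequality. Comparing `v` with its translates proves it on
balls that lie well inside `Ω`. Every boundary point has a neighbourhood whose part in `Ω` can be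
pushed into such a ball (by convexity, or along an inward normal), so the inequality holds there,
and overlapping pieces are glued along a finite cover of the connected set `Ω`.
-/

noncomputable section

namespace CahnHilliard

variable {d : ℕ}

/-! ### Square-integrable functions -/

section SquareIntegrable

variable {X V : Type*} [MeasurableSpace X] {μ : Measure X} [NormedAddCommGroup V]

theorem eLpNorm_two_sq (f : X → V) (μ : Measure X) :
    eLpNorm f 2 μ ^ 2 = ∫⁻ x, ‖f x‖ₑ ^ 2 ∂μ := by
  simpa using eLpNorm_nnreal_pow_eq_lintegral (f := f) (μ := μ) (p := 2) two_ne_zero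

theorem eLpNorm_two_restrict_union_le (f : X → V) (μ : Measure X) (A B : Set X) :
    eLpNorm f 2 (μ.restrict (A ∪ B)) ≤
      eLpNorm f 2 (μ.restrict A) + eLpNorm f 2 (μ.restrict B) := by
  rw [← ENNReal.pow_le_pow_left_iff two_ne_zero]
  calc eLpNorm f 2 (μ.restrict (A ∪ B)) ^ 2
      = ∫⁻ x in A ∪ B, ‖f x‖ₑ ^ 2 ∂μ := eLpNorm_two_sq _ _
    _ ≤ (∫⁻ x in A, ‖f x‖ₑ ^ 2 ∂μ) + ∫⁻ x in B, ‖f x‖ₑ ^ 2 ∂μ := lintegral_union_le _ _ _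
    _ = eLpNorm f 2 (μ.restrict A) ^ 2 + eLpNorm f 2 (μ.restrict B) ^ 2 := by
        rw [eLpNorm_two_sq, eLpNorm_two_sq]
    _ ≤ (eLpNorm f 2 (μ.restrict A) + eLpNorm f 2 (μ.restrict B)) ^ 2 := by
        rw [add_sq]
        gcongr
        exact le_self_add

variable [InnerProductSpace ℝ V]

theorem inner_toLp_toLp {f g : X → V} (hf : MemLp f 2 μ) (hg : MemLp g 2 μ) :
    inner ℝ (hf.toLp f) (hg.toLp g) = ∫ x, inner ℝ (f x) (g x) ∂μ := by
  rw [L2.inner_def]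
  refine integral_congr_ae ?_
  filter_upwards [hf.coeFn_toLp, hg.coeFn_toLp] with x hfx hgx
  rw [hfx, hgx]

theorem abs_integral_inner_le {f g : X → V} (hf : MemLp f 2 μ) (hg : MemLp g 2 μ) :
    |∫ x, inner ℝ (f x) (g x) ∂μ| ≤ (eLpNorm f 2 μ).toReal * (eLpNorm g 2 μ).toReal := by
  simpa only [inner_toLp_toLp hf hg, Lp.norm_toLp] using
    abs_real_inner_le_norm (hf.toLp f) (hg.toLp g)

theorem integral_inner_self_eq_sq {f : X → V} (hf : MemLp f 2 μ) :
    ∫ x, inner ℝ (f x) (f x) ∂μ = (eLpNorm f 2 μ).toReal ^ 2 := by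
  rw [← inner_toLp_toLp hf hf, real_inner_self_eq_norm_sq, Lp.norm_toLp]

theorem toReal_eLpNorm_add_smul_sq {f g : X → V} (hf : MemLp f 2 μ) (hg : MemLp g 2 μ) (c : ℝ) :
    (eLpNorm (f + c • g) 2 μ).toReal ^ 2 = (eLpNorm f 2 μ).toReal ^ 2 +
      2 * c * (∫ x, inner ℝ (f x) (g x) ∂μ) + c ^ 2 * (eLpNorm g 2 μ).toReal ^ 2 := by
  rw [← Lp.norm_toLp _ (hf.add (hg.const_smul c)), MemLp.toLp_add hf (hg.const_smul c),
    MemLp.toLp_const_smul c hg, norm_add_sq_real, inner_smul_right, norm_smul,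
    inner_toLp_toLp hf hg, Lp.norm_toLp, Lp.norm_toLp, mul_pow, Real.norm_eq_abs, sq_abs]
  ring

theorem norm_le_of_dense_of_abs_inner_le {s : Set V} (hs : Dense s) {z : V} {M : ℝ} (hM : 0 ≤ M)
    (h : ∀ x ∈ s, |inner ℝ z x| ≤ M * ‖x‖) : ‖z‖ ≤ M := by
  have h' : ∀ x, |inner ℝ z x| ≤ M * ‖x‖ := fun x =>
    hs.induction h (isClosed_le (by fun_prop) (by fun_prop)) x
  rw [← innerSL_apply_norm (𝕜 := ℝ) z]
  exact ContinuousLinearMap.opNorm_le_bound _ hM h'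

theorem integrable_mul {f g : X → ℝ} (hf : MemLp f 2 μ) (hg : MemLp g 2 μ) :
    Integrable (fun x => f x * g x) μ :=
  hf.integrable_mul hg

theorem abs_integral_mul_le {f g : X → ℝ} (hf : MemLp f 2 μ) (hg : MemLp g 2 μ) :
    |∫ x, f x * g x ∂μ| ≤ (eLpNorm f 2 μ).toReal * (eLpNorm g 2 μ).toReal := by
  simpa [RCLike.inner_apply, mul_comm] using abs_integral_inner_le hf hg

theorem integral_mul_self_eq_sq {f : X → ℝ} (hf : MemLp f 2 μ) :
    ∫ x, f x * f x ∂μ = (eLpNorm f 2 μ).toReal ^ 2 := by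
  simpa [RCLike.inner_apply, sq] using integral_inner_self_eq_sq hf

end SquareIntegrable

/-! ### Test functions -/

/-- The test functions of `Ω`: smooth functions with compact support inside `Ω`. -/
structure IsTestFunction (Ω : Set (E d)) (φ : E d → ℝ) : Prop where
  contDiff : ContDiff ℝ ∞ φ
  hasCompactSupport : HasCompactSupport φ
  tsupport_subset : tsupport φ ⊆ Ω

namespace IsTestFunction

variable {Ω A : Set (E d)} {φ : E d → ℝ}

theorem memLp (hφ : IsTestFunction Ω φ) (p : ENNReal) (μ : Measure (E d))
    [IsFiniteMeasureOnCompacts μ] : MemLp φ p μ :=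
  hφ.contDiff.continuous.memLp_of_hasCompactSupport hφ.hasCompactSupport

theorem eq_zero_of_notMem (hφ : IsTestFunction Ω φ) {x : E d} (hx : x ∉ Ω) : φ x = 0 :=
  image_eq_zero_of_notMem_tsupport fun h => hx (hφ.tsupport_subset h)

theorem memLp_fderiv_apply (hφ : IsTestFunction Ω φ) (e : E d) (p : ENNReal)
    (μ : Measure (E d)) [IsFiniteMeasureOnCompacts μ] :
    MemLp (fun x => fderiv ℝ φ x e) p μ :=
  ((hφ.contDiff.continuous_fderiv (by simp)).clm_apply continuous_const).memLp_of_hasCompactSupport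
    (hφ.hasCompactSupport.fderiv_apply ℝ e)

theorem comp_sub_right (hφ : IsTestFunction A φ) {a : E d} (ha : ∀ y ∈ A, y + a ∈ Ω) :
    IsTestFunction Ω fun y => φ (y - a) where
  contDiff := hφ.contDiff.comp (contDiff_id.sub contDiff_const)
  hasCompactSupport := hφ.hasCompactSupport.comp_homeomorph (Homeomorph.subRight a)
  tsupport_subset := by
    intro y hy
    have hy' : y - a ∈ tsupport φ := by
      have := tsupport_comp_eq_preimage φ (Homeomorph.subRight a) ▸ hy
      exact this
    simpa using ha _ (hφ.tsupport_subset hy')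

theorem add {ψ : E d → ℝ} (hφ : IsTestFunction Ω φ) (hψ : IsTestFunction Ω ψ) :
    IsTestFunction Ω (φ + ψ) where
  contDiff := hφ.contDiff.add hψ.contDiff
  hasCompactSupport := hφ.hasCompactSupport.add hψ.hasCompactSupport
  tsupport_subset := (tsupport_add φ ψ).trans
    (Set.union_subset hφ.tsupport_subset hψ.tsupport_subset)

theorem const_smul (c : ℝ) (hφ : IsTestFunction Ω φ) : IsTestFunction Ω (c • φ) where
  contDiff := contDiff_const.smul hφ.contDiff
  hasCompactSupport := hφ.hasCompactSupport.mono (Function.support_const_smul_subset c φ)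
  tsupport_subset :=
    (closure_mono (Function.support_const_smul_subset c φ)).trans hφ.tsupport_subset

theorem zero (Ω : Set (E d)) : IsTestFunction Ω 0 where
  contDiff := contDiff_const
  hasCompactSupport := HasCompactSupport.zero
  tsupport_subset := by simp [tsupport]

end IsTestFunction

/-- The classes of test functions of `A` in `L²(A)`. -/
def testSpace (A : Set (E d)) : Submodule ℝ (Lp ℝ 2 (volume.restrict A)) where
  carrier := {f | ∃ φ, IsTestFunction A φ ∧ f =ᵐ[volume.restrict A] φ}
  add_mem' := by
    rintro f g ⟨φ, hφ, hfφ⟩ ⟨ψ, hψ, hgψ⟩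
    exact ⟨φ + ψ, hφ.add hψ, (Lp.coeFn_add f g).trans (hfφ.add hgψ)⟩
  zero_mem' := ⟨0, .zero A, Lp.coeFn_zero _ _ _⟩
  smul_mem' := by
    rintro c f ⟨φ, hφ, hfφ⟩
    exact ⟨c • φ, hφ.const_smul c, (Lp.coeFn_smul c f).trans (hfφ.const_smul c)⟩

theorem dense_testSpace {A : Set (E d)} (hA : IsOpen A) :
    Dense (testSpace A : Set (Lp ℝ 2 (volume.restrict A))) := by
  rw [Submodule.dense_iff_topologicalClosure_eq_top, Submodule.topologicalClosure_eq_top_iff,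
    Submodule.eq_bot_iff]
  intro f hf
  rw [Submodule.mem_orthogonal] at hf
  have hzero : ∀ᵐ x ∂volume.restrict A, x ∈ A → f x = 0 := by
    refine hA.ae_eq_zero_of_integral_contDiff_smul_eq_zero
      (((Lp.memLp f).locallyIntegrable one_le_two).locallyIntegrableOn A) fun φ h1 h2 h3 => ?_
    have hφ : IsTestFunction A φ := ⟨h1, h2, h3⟩
    have horth := hf ((hφ.memLp 2 _).toLp φ) ⟨φ, hφ, (hφ.memLp 2 _).coeFn_toLp⟩
    rw [← Lp.toLp_coeFn f (Lp.memLp f), inner_toLp_toLp] at horth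
    simpa [RCLike.inner_apply, mul_comm] using horth
  rw [Lp.eq_zero_iff_ae_eq_zero]
  filter_upwards [hzero, ae_restrict_mem hA.measurableSet] with x hx hxA using hx hxA

theorem eLpNorm_le_of_forall_abs_integral_mul_le {A : Set (E d)} (hA : IsOpen A) {D : E d → ℝ}
    (hD : MemLp D 2 (volume.restrict A)) {M : ℝ} (hM : 0 ≤ M)
    (h : ∀ φ, IsTestFunction A φ →
      |∫ x in A, D x * φ x| ≤ M * (eLpNorm φ 2 (volume.restrict A)).toReal) :
    eLpNorm D 2 (volume.restrict A) ≤ ENNReal.ofReal M := by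
  have hnorm : ‖hD.toLp D‖ ≤ M := by
    refine norm_le_of_dense_of_abs_inner_le (dense_testSpace hA) hM ?_
    rintro f ⟨φ, hφ, hfφ⟩
    have hf : f = (hφ.memLp 2 _).toLp φ := by
      rw [← Lp.toLp_coeFn f (Lp.memLp f)]
      exact MemLp.toLp_congr _ _ hfφ
    rw [hf, inner_toLp_toLp, Lp.norm_toLp]
    simpa [RCLike.inner_apply, mul_comm] using h φ hφ
  rw [Lp.norm_toLp] at hnorm
  exact (ENNReal.le_ofReal_iff_toReal_le hD.2.ne hM).2 hnorm

/-! ### Gradients and integration by parts -/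

/-- Integration by parts of `v`, with gradient `G`, against `φ` without boundary term. -/
def HasIBP (Ω : Set (E d)) (v : E d → ℝ) (G : E d → E d) (φ : E d → ℝ) : Prop :=
  ∀ i, ∫ x in Ω, v x * fderiv ℝ φ x (EuclideanSpace.single i 1) = -∫ x in Ω, G x i * φ x

/-- The functions against which elements of `Ḣ¹` are integrated by parts without boundary term:
test functions of `Ω` and, in the periodic case, also smooth periodic functions. -/
def BoundaryCondition.IsTest : BoundaryCondition → Set (E d) → (E d → ℝ) → Prop
  | .neumann, Ω, φ => IsTestFunction Ω φ
  | .periodic L, Ω, φ => IsTestFunction Ω φ ∨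
      (ContDiff ℝ ∞ φ ∧ ∀ x i, φ (x + L • EuclideanSpace.single i 1) = φ x)

section Gradient

variable {Ω : Set (E d)} {bc : BoundaryCondition} {v w φ : E d → ℝ} {G K : E d → E d}

theorem memLp_of_continuous {V : Type*} [NormedAddCommGroup V] (hΩ : Bornology.IsBounded Ω)
    {φ : E d → V} (hφ : Continuous φ) (p : ENNReal) : MemLp φ p (volume.restrict Ω) := by
  have hK : IsCompact (closure Ω) := hΩ.isCompact_closure
  have : IsFiniteMeasure (volume.restrict (closure Ω)) := ⟨by simpa using hK.measure_lt_top⟩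
  obtain ⟨C, hC⟩ := hK.exists_bound_of_continuousOn hφ.continuousOn
  refine (MemLp.of_bound hφ.aestronglyMeasurable C ?_).mono_measure
    (Measure.restrict_mono subset_closure le_rfl)
  filter_upwards [ae_restrict_mem isClosed_closure.measurableSet] with x hx using hC x hx

theorem memLp_coord (hG : MemLp G 2 (volume.restrict Ω)) (i : Fin d) :
    MemLp (fun x => G x i) 2 (volume.restrict Ω) :=
  hG.continuousLinearMap_comp (EuclideanSpace.proj i : E d →L[ℝ] ℝ)

theorem HasIBP.congr (h : HasIBP Ω v G φ) (hv : v =ᵐ[volume.restrict Ω] w)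
    (hG : G =ᵐ[volume.restrict Ω] K) : HasIBP Ω w K φ := by
  intro i
  have hl : ∫ x in Ω, w x * fderiv ℝ φ x (EuclideanSpace.single i 1) =
      ∫ x in Ω, v x * fderiv ℝ φ x (EuclideanSpace.single i 1) :=
    integral_congr_ae (by filter_upwards [hv] with x hx; rw [hx])
  have hr : ∫ x in Ω, K x i * φ x = ∫ x in Ω, G x i * φ x :=
    integral_congr_ae (by filter_upwards [hG] with x hx; rw [hx])
  rw [hl, hr, h i]

theorem HasIBP.add (hΩ : Bornology.IsBounded Ω) (hφ : ContDiff ℝ ∞ φ)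
    (hv : MemLp v 2 (volume.restrict Ω)) (hw : MemLp w 2 (volume.restrict Ω))
    (hG : MemLp G 2 (volume.restrict Ω)) (hK : MemLp K 2 (volume.restrict Ω))
    (h : HasIBP Ω v G φ) (h' : HasIBP Ω w K φ) : HasIBP Ω (v + w) (G + K) φ := by
  intro i
  have hφ₁ : MemLp (fun x => fderiv ℝ φ x (EuclideanSpace.single i 1)) 2 (volume.restrict Ω) :=
    memLp_of_continuous hΩ ((hφ.continuous_fderiv (by simp)).clm_apply continuous_const) 2
  have hφ₀ : MemLp φ 2 (volume.restrict Ω) := memLp_of_continuous hΩ hφ.continuous 2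
  simp only [Pi.add_apply, PiLp.add_apply, add_mul]
  rw [integral_add (integrable_mul hv hφ₁) (integrable_mul hw hφ₁),
    integral_add (integrable_mul (memLp_coord hG i) hφ₀) (integrable_mul (memLp_coord hK i) hφ₀),
    h i, h' i, neg_add]

theorem HasIBP.const_smul (h : HasIBP Ω v G φ) (c : ℝ) : HasIBP Ω (c • v) (c • G) φ := by
  intro i
  simp only [Pi.smul_apply, PiLp.smul_apply, smul_eq_mul, mul_assoc]
  rw [integral_const_mul, integral_const_mul, h i, mul_neg]

theorem hasIBP_one (h : ∀ i, ∫ x in Ω, fderiv ℝ φ x (EuclideanSpace.single i 1) = 0) :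
    HasIBP Ω 1 0 φ := fun i => by simpa using h i

namespace BoundaryCondition

theorem IsTest.contDiff (hφ : bc.IsTest Ω φ) : ContDiff ℝ ∞ φ := by
  cases bc with
  | neumann => exact IsTestFunction.contDiff hφ
  | periodic L => exact hφ.elim (·.contDiff) (·.1)

theorem hasGradient_iff : bc.HasGradient Ω v G ↔ MemLp v 2 (volume.restrict Ω) ∧
    MemLp G 2 (volume.restrict Ω) ∧ ∀ φ, bc.IsTest Ω φ → HasIBP Ω v G φ := by
  cases bc with
  | neumann =>
    exact ⟨fun h => ⟨h.1, h.2, fun φ hφ => h.3 φ hφ.1 hφ.2 hφ.3⟩,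
      fun h => ⟨h.1, h.2.1, fun φ h1 h2 h3 => h.2.2 φ ⟨h1, h2, h3⟩⟩⟩
  | periodic L =>
    exact ⟨fun h => ⟨h.1.1, h.1.2, fun φ hφ =>
        hφ.elim (fun hφ => h.1.3 φ hφ.1 hφ.2 hφ.3) (fun hφ => h.2 φ hφ.1 hφ.2)⟩,
      fun h => ⟨⟨h.1, h.2.1, fun φ h1 h2 h3 => h.2.2 φ (.inl ⟨h1, h2, h3⟩)⟩,
        fun φ h1 h2 => h.2.2 φ (.inr ⟨h1, h2⟩)⟩⟩

namespace HasGradient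

theorem isWeakGradient (h : bc.HasGradient Ω v G) : IsWeakGradient Ω v G := by
  cases bc with
  | neumann => exact h
  | periodic L => exact h.1

theorem memLp (h : bc.HasGradient Ω v G) : MemLp v 2 (volume.restrict Ω) :=
  h.isWeakGradient.memLp

theorem memLp_grad (h : bc.HasGradient Ω v G) : MemLp G 2 (volume.restrict Ω) :=
  h.isWeakGradient.memLp_grad

theorem congr (h : bc.HasGradient Ω v G) (hv : v =ᵐ[volume.restrict Ω] w)
    (hG : G =ᵐ[volume.restrict Ω] K) : bc.HasGradient Ω w K := by
  rw [hasGradient_iff] at h ⊢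
  exact ⟨(memLp_congr_ae hv).1 h.1, (memLp_congr_ae hG).1 h.2.1,
    fun φ hφ => (h.2.2 φ hφ).congr hv hG⟩

theorem add (hΩ : Bornology.IsBounded Ω) (h : bc.HasGradient Ω v G)
    (h' : bc.HasGradient Ω w K) : bc.HasGradient Ω (v + w) (G + K) := by
  rw [hasGradient_iff] at h h' ⊢
  exact ⟨h.1.add h'.1, h.2.1.add h'.2.1, fun φ hφ =>
    HasIBP.add hΩ hφ.contDiff h.1 h'.1 h.2.1 h'.2.1 (h.2.2 φ hφ) (h'.2.2 φ hφ)⟩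

theorem const_smul (h : bc.HasGradient Ω v G) (c : ℝ) : bc.HasGradient Ω (c • v) (c • G) := by
  rw [hasGradient_iff] at h ⊢
  exact ⟨h.1.const_smul c, h.2.1.const_smul c, fun φ hφ => (h.2.2 φ hφ).const_smul c⟩

end HasGradient

end BoundaryCondition

end Gradient

/-! ### Admissible domains -/

/-- Bounded sets for which the constant functions lie in `Ḣ¹` with gradient zero, so that the
evolution conserves the average. -/
structure BoundaryCondition.IsAdmissible (bc : BoundaryCondition) (Ω : Set (E d)) : Prop where
  isBounded : Bornology.IsBounded Ω
  hasGradient_one : bc.HasGradient Ω 1 0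

/-- The cube `(0, L)^d`. -/
abbrev openCube (d : ℕ) (L : ℝ) : Set (E d) := {x | ∀ i, 0 < x i ∧ x i < L}

theorem isOpen_openCube (L : ℝ) : IsOpen (openCube d L) := by
  simp only [openCube, Set.ofPred_forall]
  refine isOpen_iInter_of_finite fun i => ?_
  have hi : Continuous fun x : E d => x i := by fun_prop
  exact (isOpen_lt continuous_const hi).inter (isOpen_lt hi continuous_const)

theorem convex_openCube (L : ℝ) : Convex ℝ (openCube d L) := by
  intro x hx y hy a b ha hb hab i
  exact convex_Ioo (0 : ℝ) L (hx i) (hy i) ha hb hab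

theorem openCube_nonempty {L : ℝ} (hL : 0 < L) : (openCube d L).Nonempty :=
  ⟨WithLp.toLp 2 fun _ => L / 2, fun _ => ⟨half_pos hL, half_lt_self hL⟩⟩

theorem isBounded_openCube (L : ℝ) : Bornology.IsBounded (openCube d L) := by
  rw [isBounded_iff_forall_norm_le]
  refine ⟨√(∑ _i : Fin d, L ^ 2), fun x hx => ?_⟩
  rw [EuclideanSpace.norm_eq]
  gcongr with i
  rw [Real.norm_eq_abs, abs_of_pos (hx i).1]
  exact (hx i).2.le

theorem integral_Icc_fderiv_single_eq_zero {F : Type*} [NormedAddCommGroup F] [NormedSpace ℝ F]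
    [CompleteSpace F] {n : ℕ} {a b : Fin (n + 1) → ℝ} (hab : a ≤ b) {g : (Fin (n + 1) → ℝ) → F}
    (hg : ContDiff ℝ 1 g) (i : Fin (n + 1))
    (hper : ∀ x, g (i.insertNth (b i) x) = g (i.insertNth (a i) x)) :
    ∫ x in Set.Icc a b, fderiv ℝ g x (Pi.single i 1) = 0 := by
  -- Apply the divergence theorem to the vector field with `i`-th component `g` and all others zero.
  have hdiv := integral_divergence_of_hasFDerivAt_off_countable' a b hab
    (fun j x => if j = i then g x else 0) (fun j x => if j = i then fderiv ℝ g x else 0)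
    ∅ Set.countable_empty
    (fun j => by split_ifs; exacts [hg.continuous.continuousOn, continuousOn_const])
    (fun x _ j => by
      split_ifs
      exacts [(hg.differentiable one_ne_zero x).hasFDerivAt, hasFDerivAt_const _ _])
    (by
      refine (continuous_finsetSum _ fun j _ => ?_).integrableOn_Icc
      split_ifs
      exacts [(hg.continuous_fderiv one_ne_zero).clm_apply continuous_const,
        by simpa using continuous_const])
  have hfaces : ∀ j (x : Fin n → ℝ), (if j = i then g (j.insertNth (b j) x) else 0) =
      if j = i then g (j.insertNth (a j) x) else 0 := by
    intro j x
    split_ifs with hj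
    exacts [by rw [hj, hper], rfl]
  simp only [hfaces, sub_self, Finset.sum_const_zero] at hdiv
  rw [← hdiv]
  congr 1 with x
  rw [Finset.sum_eq_single i (fun j _ hj => by simp [hj]) (by simp), if_pos rfl]

theorem setIntegral_openCube_eq (L : ℝ) (f : E d → ℝ) :
    ∫ x in openCube d L, f x =
      ∫ x in Set.Icc (fun _ => (0 : ℝ)) (fun _ => L), f (WithLp.toLp 2 x) := by
  have hpre : WithLp.toLp 2 ⁻¹' openCube d L = Set.univ.pi fun _ => Set.Ioo 0 L := by
    ext x
    simp [Set.mem_pi]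
  rw [← (PiLp.volume_preserving_toLp (Fin d)).setIntegral_preimage_emb
    (MeasurableEquiv.toLp 2 (Fin d → ℝ)).measurableEmbedding, hpre]
  exact setIntegral_congr_set
    (Measure.univ_pi_Ioo_ae_eq_Icc (μ := fun _ => (volume : Measure ℝ)))

theorem integral_fderiv_openCube_eq_zero {L : ℝ} (hL : 0 ≤ L) {φ : E d → ℝ}
    (hφ : ContDiff ℝ 1 φ) (hper : ∀ x i, φ (x + L • EuclideanSpace.single i 1) = φ x)
    (i : Fin d) : ∫ x in openCube d L, fderiv ℝ φ x (EuclideanSpace.single i 1) = 0 := by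
  obtain ⟨n, rfl⟩ : ∃ n, d = n + 1 := ⟨d - 1, by have := i.2; omega⟩
  let T : (Fin (n + 1) → ℝ) →L[ℝ] E (n + 1) :=
    (PiLp.continuousLinearEquiv 2 ℝ fun _ : Fin (n + 1) => ℝ).symm
  have hfderiv : ∀ x, fderiv ℝ φ (WithLp.toLp 2 x) (EuclideanSpace.single i 1) =
      fderiv ℝ (φ ∘ T) x (Pi.single i 1) := by
    intro x
    rw [fderiv_comp x (hφ.differentiable one_ne_zero _) T.differentiableAt, T.fderiv]
    rfl
  simp only [setIntegral_openCube_eq, hfderiv]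
  refine integral_Icc_fderiv_single_eq_zero (fun _ => hL) (hφ.comp T.contDiff) i fun x => ?_
  have hshift : T (i.insertNth L x) = T (i.insertNth 0 x) + L • EuclideanSpace.single i 1 := by
    ext k
    rcases Fin.eq_self_or_eq_succAbove i k with rfl | ⟨l, rfl⟩ <;> simp [T]
  rw [Function.comp_apply, Function.comp_apply, hshift, hper]

theorem IsTestFunction.integral_fderiv_eq_zero {Ω : Set (E d)} {φ : E d → ℝ}
    (hφ : IsTestFunction Ω φ) (e : E d) : ∫ x in Ω, fderiv ℝ φ x e = 0 := by
  rw [setIntegral_eq_integral_of_forall_compl_eq_zero]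
  · simpa using integral_mul_fderiv_eq_neg_fderiv_mul_of_integrable (𝕜 := ℝ)
      (μ := (volume : Measure (E d))) (f := fun _ => (1 : ℝ)) (g := φ) (v := e) (by simp)
      (by simpa using memLp_one_iff_integrable.1 (hφ.memLp_fderiv_apply e 1 volume))
      (by simpa using memLp_one_iff_integrable.1 (hφ.memLp 1 volume))
      (by fun_prop) fun x _ => hφ.contDiff.differentiable (by simp) x
  · intro x hx
    have hx' : x ∉ tsupport (fderiv ℝ φ) := fun h =>
      hx (hφ.tsupport_subset (tsupport_fderiv_subset ℝ h))
    rw [image_eq_zero_of_notMem_tsupport hx', zero_apply]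

theorem BoundaryCondition.IsDomain.isAdmissible {bc : BoundaryCondition} {Ω : Set (E d)}
    (hΩ : bc.IsDomain Ω) : bc.IsAdmissible Ω := by
  have hbdd : Bornology.IsBounded Ω := by
    cases bc with
    | neumann => exact hΩ.2.2.1
    | periodic L => exact hΩ.2 ▸ isBounded_openCube L
  refine ⟨hbdd, hasGradient_iff.2
    ⟨memLp_of_continuous hbdd continuous_const 2, MemLp.zero, fun φ hφ => hasIBP_one fun i => ?_⟩⟩
  cases bc with
  | neumann => exact IsTestFunction.integral_fderiv_eq_zero hφ _
  | periodic L =>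
    rcases hφ with hφ | ⟨hφ, hper⟩
    · exact hφ.integral_fderiv_eq_zero _
    · obtain ⟨hL, rfl⟩ := hΩ
      exact integral_fderiv_openCube_eq_zero hL.le (hφ.of_le (by simp)) hper i

/-! ### The translation inequality -/

section Translation

variable {Ω A : Set (E d)} {v φ : E d → ℝ} {G : E d → E d}

theorem eLpNorm_comp_add_right_le (hΩ : MeasurableSet Ω)
    (hv : AEStronglyMeasurable v (volume.restrict Ω)) {e : E d} (hAe : ∀ y ∈ A, y + e ∈ Ω)
    (p : ENNReal) :
    eLpNorm (fun y => v (y + e)) p (volume.restrict A) ≤ eLpNorm v p (volume.restrict Ω) := by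
  rw [← eLpNorm_comp_measurePreserving hv
    ((measurePreserving_add_right volume e).restrict_preimage hΩ)]
  exact eLpNorm_mono_measure _ (Measure.restrict_mono hAe le_rfl)

theorem memLp_comp_add_right (hΩ : MeasurableSet Ω) {p : ENNReal}
    (hv : MemLp v p (volume.restrict Ω)) {e : E d} (hAe : ∀ y ∈ A, y + e ∈ Ω) :
    MemLp (fun y => v (y + e)) p (volume.restrict A) :=
  (hv.comp_measurePreserving
    ((measurePreserving_add_right volume e).restrict_preimage hΩ)).mono_measure
    (Measure.restrict_mono hAe le_rfl)

theorem IsWeakGradient.integral_mul_fderiv (h : IsWeakGradient Ω v G)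
    (hφ : IsTestFunction Ω φ) (e : E d) :
    ∫ x in Ω, v x * fderiv ℝ φ x e = -∫ x in Ω, inner ℝ (G x) (φ x • e) := by
  have he : e = ∑ i, e i • EuclideanSpace.single i (1 : ℝ) := by
    ext j
    simp [Finset.sum_apply, Pi.single_apply]
  have hleft : ∀ x, v x * fderiv ℝ φ x e =
      ∑ i, e i * (v x * fderiv ℝ φ x (EuclideanSpace.single i 1)) := by
    intro x
    conv_lhs => rw [he, map_sum, Finset.mul_sum]
    simp only [map_smul, smul_eq_mul, mul_left_comm]
  have hright : ∀ x, inner ℝ (G x) (φ x • e) = ∑ i, e i * (G x i * φ x) := by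
    intro x
    simp [PiLp.inner_apply, mul_comm, mul_left_comm, mul_assoc]
  simp_rw [hleft, hright]
  rw [integral_finsetSum _ fun i _ =>
      (integrable_mul h.memLp (hφ.memLp_fderiv_apply _ 2 _)).const_mul _,
    integral_finsetSum _ fun i _ =>
      (integrable_mul (memLp_coord h.memLp_grad i) (hφ.memLp 2 _)).const_mul _,
    ← Finset.sum_neg_distrib]
  refine Finset.sum_congr rfl fun i _ => ?_
  rw [integral_const_mul, integral_const_mul,
    h.integral_eq φ hφ.contDiff hφ.hasCompactSupport hφ.tsupport_subset i, mul_neg]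

theorem IsWeakGradient.abs_integral_mul_fderiv_le (h : IsWeakGradient Ω v G)
    (hφ : IsTestFunction Ω φ) (e : E d) :
    |∫ x in Ω, v x * fderiv ℝ φ x e| ≤
      ‖e‖ * (eLpNorm G 2 (volume.restrict Ω)).toReal * (eLpNorm φ 2 volume).toReal := by
  have hφe : MemLp (fun x => φ x • e) 2 volume :=
    (hφ.contDiff.continuous.smul continuous_const).memLp_of_hasCompactSupport
      hφ.hasCompactSupport.smul_right
  have hle : (eLpNorm (fun x => φ x • e) 2 (volume.restrict Ω)).toReal ≤
      ‖e‖ * (eLpNorm φ 2 volume).toReal := by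
    have hbound : eLpNorm (fun x => φ x • e) 2 (volume.restrict Ω) ≤
        ENNReal.ofReal ‖e‖ * eLpNorm φ 2 volume :=
      (eLpNorm_mono_measure _ Measure.restrict_le_self).trans
        (eLpNorm_le_mul_eLpNorm_of_ae_le_mul
          (ae_of_all _ fun x => by rw [norm_smul, mul_comm]) 2)
    have hfin := (hφ.memLp 2 volume).2.ne
    simpa [ENNReal.toReal_mul] using ENNReal.toReal_mono (by finiteness) hbound
  calc |∫ x in Ω, v x * fderiv ℝ φ x e|
      = |∫ x in Ω, inner ℝ (G x) (φ x • e)| := by rw [h.integral_mul_fderiv hφ e, abs_neg]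
    _ ≤ (eLpNorm G 2 (volume.restrict Ω)).toReal *
          (eLpNorm (fun x => φ x • e) 2 (volume.restrict Ω)).toReal :=
        abs_integral_inner_le h.memLp_grad (hφe.restrict Ω)
    _ ≤ (eLpNorm G 2 (volume.restrict Ω)).toReal * (‖e‖ * (eLpNorm φ 2 volume).toReal) := by
        gcongr
    _ = _ := by ring

theorem hasDerivAt_integral_mul_comp_sub {μ : Measure (E d)} (hv : Integrable v μ)
    (hφ : ContDiff ℝ 1 φ) (hφc : HasCompactSupport φ) (e : E d) (s : ℝ) :
    HasDerivAt (fun s : ℝ => ∫ y, v y * φ (y - s • e) ∂μ)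
      (∫ y, v y * fderiv ℝ φ (y - s • e) (-e) ∂μ) s := by
  have hφ' := hφ.continuous_fderiv one_ne_zero
  obtain ⟨C, hC⟩ := hφc.exists_bound_of_continuous hφ.continuous
  obtain ⟨C', hC'⟩ := (hφc.fderiv (𝕜 := ℝ)).exists_bound_of_continuous hφ'
  have hint : ∀ s : ℝ, Integrable (fun y => v y * φ (y - s • e)) μ := fun s =>
    hv.mul_bdd (hφ.continuous.comp (by fun_prop)).aestronglyMeasurable (ae_of_all _ fun y => hC _)
  refine (hasDerivAt_integral_of_dominated_loc_of_deriv_le (s := Set.univ)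
    (bound := fun y => |v y| * (C' * ‖e‖))
    (F' := fun s y => v y * fderiv ℝ φ (y - s • e) (-e)) Filter.univ_mem
    (Eventually.of_forall fun s => (hint s).1) (hint s) ?_ (ae_of_all _ fun y s _ => ?_)
    (hv.abs.mul_const _) (ae_of_all _ fun y s _ => ?_)).2
  · exact hv.1.mul ((hφ'.comp (by fun_prop)).clm_apply continuous_const).aestronglyMeasurable
  · rw [norm_mul, Real.norm_eq_abs, ← norm_neg e]
    gcongr
    exact ContinuousLinearMap.le_of_opNorm_le _ (hC' _) _
  · have hline : HasDerivAt (fun s : ℝ => y - s • e) (-e) s := by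
      simpa using ((hasDerivAt_id s).smul_const e).const_sub y
    exact ((hφ.differentiable one_ne_zero _).hasFDerivAt.comp_hasDerivAt s hline).const_mul (v y)

theorem IsTestFunction.setIntegral_mul_comp_sub (hφ : IsTestFunction A φ) (v : E d → ℝ) {e : E d}
    (hAe : ∀ y ∈ A, y + e ∈ Ω) :
    ∫ y in Ω, v y * φ (y - e) = ∫ y in A, v (y + e) * φ y := by
  rw [setIntegral_eq_integral_of_forall_compl_eq_zero,
    setIntegral_eq_integral_of_forall_compl_eq_zero, ← integral_add_right_eq_self _ e]
  · simp only [add_sub_cancel_right]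
  · intro y hy
    rw [hφ.eq_zero_of_notMem hy, mul_zero]
  · intro y hy
    rw [hφ.eq_zero_of_notMem fun hy' => hy (by simpa using hAe _ hy'), mul_zero]

theorem IsWeakGradient.eLpNorm_translate_sub_le (h : IsWeakGradient Ω v G)
    (hΩ : MeasurableSet Ω) (hfin : volume Ω ≠ ⊤) (hA : IsOpen A) {e : E d}
    (hAe : ∀ y ∈ A, ∀ s ∈ Set.Icc (0 : ℝ) 1, y + s • e ∈ Ω) :
    eLpNorm (fun y => v (y + e) - v y) 2 (volume.restrict A) ≤
      ENNReal.ofReal ‖e‖ * eLpNorm G 2 (volume.restrict Ω) := by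
  have : IsFiniteMeasure (volume.restrict Ω) := ⟨by simpa using hfin.lt_top⟩
  have hA₀ : ∀ y ∈ A, y + (0 : ℝ) • e ∈ Ω := fun y hy => hAe y hy 0 (by simp)
  have hA₁ : ∀ y ∈ A, y + (1 : ℝ) • e ∈ Ω := fun y hy => hAe y hy 1 (by simp)
  have hve : MemLp (fun y => v (y + e)) 2 (volume.restrict A) :=
    memLp_comp_add_right hΩ h.memLp (by simpa using hA₁)
  have hv : MemLp v 2 (volume.restrict A) :=
    h.memLp.mono_measure (Measure.restrict_mono (fun y hy => by simpa using hA₀ y hy) le_rfl)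
  rw [← ENNReal.ofReal_toReal h.memLp_grad.2.ne, ← ENNReal.ofReal_mul (norm_nonneg _)]
  refine eLpNorm_le_of_forall_abs_integral_mul_le hA (hve.sub hv) (by positivity) fun φ hφ => ?_
  -- The integral below is the derivative of `s ↦ ∫ v(y) φ(y - s e) dy`.
  have hderiv : ∀ s ∈ Set.Icc (0 : ℝ) 1, ‖∫ y in Ω, v y * fderiv ℝ φ (y - s • e) (-e)‖ ≤
      ‖e‖ * (eLpNorm G 2 (volume.restrict Ω)).toReal *
        (eLpNorm φ 2 (volume.restrict A)).toReal := by
    intro s hs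
    have hbound := h.abs_integral_mul_fderiv_le
      (hφ.comp_sub_right (a := s • e) fun y hy => hAe y hy s hs) (-e)
    have hnorm : eLpNorm (fun y => φ (y - s • e)) 2 volume = eLpNorm φ 2 (volume.restrict A) := by
      rw [eLpNorm_restrict_eq_of_support_subset ((subset_tsupport φ).trans hφ.tsupport_subset)]
      exact eLpNorm_comp_measurePreserving (hφ.memLp 2 volume).1
        (measurePreserving_sub_right volume (s • e))
    simpa only [fderiv_comp_sub, norm_neg, hnorm, Real.norm_eq_abs] using hbound
  have hmv := (convex_Icc (0 : ℝ) 1).norm_image_sub_le_of_norm_hasDerivWithin_le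
    (fun s _ => (hasDerivAt_integral_mul_comp_sub (h.memLp.integrable one_le_two)
      (hφ.contDiff.of_le (by simp)) hφ.hasCompactSupport e s).hasDerivWithinAt) hderiv
    (Set.left_mem_Icc.2 zero_le_one) (Set.right_mem_Icc.2 zero_le_one)
  rw [hφ.setIntegral_mul_comp_sub v hA₁, hφ.setIntegral_mul_comp_sub v hA₀] at hmv
  simp only [one_smul, zero_smul, add_zero] at hmv
  rw [← integral_sub (integrable_mul hve (hφ.memLp 2 _)) (integrable_mul hv (hφ.memLp 2 _))] at hmv
  simpa [sub_mul] using hmv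

end Translation

/-! ### The Poincaré inequality -/

/-- The Poincaré inequality on the subset `A` of `Ω`, with the gradient measured on all of `Ω`. -/
def PoincareOn (Ω A : Set (E d)) : Prop :=
  ∃ C : ENNReal, C ≠ ⊤ ∧ ∀ (v : E d → ℝ) (G : E d → E d), IsWeakGradient Ω v G →
    ∃ c : ℝ, eLpNorm (fun x => v x - c) 2 (volume.restrict A) ≤
      C * eLpNorm G 2 (volume.restrict Ω)

section Poincare

variable {Ω A B : Set (E d)} {v : E d → ℝ} {G : E d → E d} {z : E d} {δ : ℝ}

theorem exists_eLpNorm_sub_const_sq_le {X : Type*} [MeasurableSpace X] {μ : Measure X}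
    [IsFiniteMeasure μ] [NeZero μ] {v : X → ℝ} (hv : Measurable v) :
    ∃ c, eLpNorm (fun x => v x - c) 2 μ ^ 2 ≤
      (∫⁻ y, ∫⁻ x, ‖v x - v y‖ₑ ^ 2 ∂μ ∂μ) / μ Set.univ := by
  have hmeas : Measurable (Function.uncurry fun y x => ‖v x - v y‖ₑ ^ 2) := by
    simp only [Function.uncurry_def]
    fun_prop
  have hint : Measurable fun y => ∫⁻ x, ‖v x - v y‖ₑ ^ 2 ∂μ := hmeas.lintegral_prod_right'
  obtain ⟨y, hy⟩ := exists_le_laverage (NeZero.ne μ) hint.aemeasurable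
  rw [laverage_eq] at hy
  exact ⟨v y, (eLpNorm_two_sq _ _).trans_le hy⟩

theorem lintegral_ball_le_lintegral_ball_add {y : E d} (hy : y ∈ Metric.ball z δ)
    (f : E d → ENNReal) :
    ∫⁻ x in Metric.ball z δ, f x ≤ ∫⁻ h in Metric.ball 0 (2 * δ), f (y + h) := by
  have hsub : (y + ·) ⁻¹' Metric.ball z δ ⊆ Metric.ball 0 (2 * δ) := by
    rw [preimage_add_ball]
    refine Metric.ball_subset_ball' ?_
    rw [Metric.mem_ball, dist_eq_norm, norm_sub_rev] at hy
    rw [dist_zero_right]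
    linarith
  rw [← (measurePreserving_add_left volume y).setLIntegral_comp_preimage_emb
    (measurableEmbedding_addLeft y)]
  exact lintegral_mono_set hsub

theorem IsWeakGradient.lintegral_ball_sub_sq_le (h : IsWeakGradient Ω v G) (hv : Measurable v)
    (hΩ : MeasurableSet Ω) (hfin : volume Ω ≠ ⊤) (hz : Metric.ball z (3 * δ) ⊆ Ω) :
    ∫⁻ y in Metric.ball z δ, ∫⁻ x in Metric.ball z δ, ‖v x - v y‖ₑ ^ 2 ≤
      volume (Metric.ball (0 : E d) (2 * δ)) *
        (ENNReal.ofReal (2 * δ) * eLpNorm G 2 (volume.restrict Ω)) ^ 2 := by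
  have htranslate : ∀ e ∈ Metric.ball (0 : E d) (2 * δ),
      ∫⁻ y in Metric.ball z δ, ‖v (y + e) - v y‖ₑ ^ 2 ≤
        (ENNReal.ofReal (2 * δ) * eLpNorm G 2 (volume.restrict Ω)) ^ 2 := by
    intro e he
    rw [mem_ball_zero_iff] at he
    rw [← eLpNorm_two_sq fun y => v (y + e) - v y]
    gcongr
    refine (h.eLpNorm_translate_sub_le hΩ hfin Metric.isOpen_ball fun y hy s hs => hz ?_).trans
      (by gcongr)
    rw [Metric.mem_ball, dist_eq_norm] at hy ⊢
    calc ‖y + s • e - z‖ = ‖(y - z) + s • e‖ := by congr 1; abel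
      _ ≤ ‖y - z‖ + ‖s • e‖ := norm_add_le _ _
      _ ≤ ‖y - z‖ + 1 * ‖e‖ := by
          rw [norm_smul, Real.norm_of_nonneg hs.1]
          gcongr
          exact hs.2
      _ < 3 * δ := by linarith
  calc ∫⁻ y in Metric.ball z δ, ∫⁻ x in Metric.ball z δ, ‖v x - v y‖ₑ ^ 2
      ≤ ∫⁻ y in Metric.ball z δ, ∫⁻ e in Metric.ball 0 (2 * δ), ‖v (y + e) - v y‖ₑ ^ 2 :=
        setLIntegral_mono' measurableSet_ball fun y hy =>
          lintegral_ball_le_lintegral_ball_add hy _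
    _ = ∫⁻ e in Metric.ball 0 (2 * δ), ∫⁻ y in Metric.ball z δ, ‖v (y + e) - v y‖ₑ ^ 2 := by
        refine lintegral_lintegral_swap (Measurable.aemeasurable ?_)
        simp only [Function.uncurry_def]
        fun_prop
    _ ≤ ∫⁻ _ in Metric.ball (0 : E d) (2 * δ),
          (ENNReal.ofReal (2 * δ) * eLpNorm G 2 (volume.restrict Ω)) ^ 2 :=
        setLIntegral_mono' measurableSet_ball htranslate
    _ = _ := by rw [setLIntegral_const, mul_comm]

theorem poincareOn_ball (hΩ : MeasurableSet Ω) (hfin : volume Ω ≠ ⊤) (hδ : 0 < δ)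
    (hz : Metric.ball z (3 * δ) ⊆ Ω) : PoincareOn Ω (Metric.ball z δ) := by
  have hB : volume (Metric.ball z δ) ≠ 0 := (Metric.measure_ball_pos volume z hδ).ne'
  have hBfin : volume (Metric.ball z δ) ≠ ⊤ := measure_ball_lt_top.ne
  have hKfin : volume (Metric.ball (0 : E d) (2 * δ)) ≠ ⊤ := measure_ball_lt_top.ne
  set C := volume (Metric.ball (0 : E d) (2 * δ)) * ENNReal.ofReal (2 * δ) ^ 2 /
    volume (Metric.ball z δ) with hC
  have hCfin : C ≠ ⊤ := ENNReal.div_ne_top (by finiteness) hB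
  refine ⟨C ^ (1 / 2 : ℝ), by finiteness, fun v G h => ?_⟩
  have hv := h.memLp.1
  have hmk : IsWeakGradient Ω (hv.mk v) G :=
    BoundaryCondition.HasGradient.congr (bc := .neumann) h hv.ae_eq_mk (ae_eq_refl G)
  have : IsFiniteMeasure (volume.restrict (Metric.ball z δ)) := ⟨by simpa using hBfin.lt_top⟩
  have : NeZero (volume.restrict (Metric.ball z δ)) := ⟨by simpa using hB⟩
  obtain ⟨c, hc⟩ := exists_eLpNorm_sub_const_sq_le (μ := volume.restrict (Metric.ball z δ))
    hv.stronglyMeasurable_mk.measurable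
  have hsub : Metric.ball z δ ⊆ Ω := (Metric.ball_subset_ball (by linarith)).trans hz
  have hmk_ae : (fun x => v x - c) =ᵐ[volume.restrict (Metric.ball z δ)]
      fun x => hv.mk v x - c := by
    filter_upwards [ae_restrict_of_ae_restrict_of_subset hsub hv.ae_eq_mk] with x hx
    rw [hx]
  refine ⟨c, (eLpNorm_congr_ae hmk_ae).trans_le ?_⟩
  rw [← ENNReal.pow_le_pow_left_iff two_ne_zero, mul_pow, ← ENNReal.rpow_natCast (C ^ _),
    ← ENNReal.rpow_mul, Nat.cast_ofNat, one_div_mul_cancel two_ne_zero, ENNReal.rpow_one]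
  calc eLpNorm (fun x => hv.mk v x - c) 2 (volume.restrict (Metric.ball z δ)) ^ 2
      ≤ _ := hc
    _ ≤ volume (Metric.ball (0 : E d) (2 * δ)) *
          (ENNReal.ofReal (2 * δ) * eLpNorm G 2 (volume.restrict Ω)) ^ 2 /
          volume (Metric.ball z δ) := by
        rw [Measure.restrict_apply_univ]
        gcongr
        exact hmk.lintegral_ball_sub_sq_le hv.stronglyMeasurable_mk.measurable hΩ hfin hz
    _ = C * eLpNorm G 2 (volume.restrict Ω) ^ 2 := by
        rw [hC, mul_pow, ENNReal.div_eq_inv_mul, ENNReal.div_eq_inv_mul]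
        ring

theorem enorm_sub_mul_measure_rpow_le {X : Type*} [MeasurableSpace X] {μ : Measure X} {f : X → ℝ}
    (hf : AEStronglyMeasurable f μ) (a c : ℝ) :
    ‖a - c‖ₑ * μ Set.univ ^ (1 / 2 : ℝ) ≤
      eLpNorm (fun x => f x - a) 2 μ + eLpNorm (fun x => f x - c) 2 μ := by
  calc ‖a - c‖ₑ * μ Set.univ ^ (1 / 2 : ℝ)
      = eLpNorm (fun _ => a - c) 2 μ := by
        rw [eLpNorm_const' _ two_ne_zero ENNReal.ofNat_ne_top, ENNReal.toReal_ofNat]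
    _ = eLpNorm ((fun x => f x - c) - fun x => f x - a) 2 μ := by
        congr 1
        ext x
        simp
    _ ≤ eLpNorm (fun x => f x - c) 2 μ + eLpNorm (fun x => f x - a) 2 μ :=
        eLpNorm_sub_le (hf.sub aestronglyMeasurable_const) (hf.sub aestronglyMeasurable_const)
          one_le_two
    _ = _ := add_comm _ _

theorem eLpNorm_sub_const_le_add {X : Type*} [MeasurableSpace X] {μ : Measure X} {f : X → ℝ}
    (hf : AEStronglyMeasurable f μ) (a c : ℝ) :
    eLpNorm (fun x => f x - a) 2 μ ≤
      eLpNorm (fun x => f x - c) 2 μ + ‖a - c‖ₑ * μ Set.univ ^ (1 / 2 : ℝ) := by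
  calc eLpNorm (fun x => f x - a) 2 μ
      = eLpNorm ((fun x => f x - c) - fun _ => a - c) 2 μ := by
        congr 1
        ext x
        simp
    _ ≤ eLpNorm (fun x => f x - c) 2 μ + eLpNorm (fun _ => a - c) 2 μ :=
        eLpNorm_sub_le (hf.sub aestronglyMeasurable_const) aestronglyMeasurable_const one_le_two
    _ = _ := by rw [eLpNorm_const' _ two_ne_zero ENNReal.ofNat_ne_top, ENNReal.toReal_ofNat]

theorem PoincareOn.union (hA : PoincareOn Ω A) (hB : PoincareOn Ω B) (hAΩ : A ⊆ Ω) (hBΩ : B ⊆ Ω)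
    (hfin : volume Ω ≠ ⊤) (hAB : volume (A ∩ B) ≠ 0) : PoincareOn Ω (A ∪ B) := by
  obtain ⟨C, hC, hA⟩ := hA
  obtain ⟨D, hD, hB⟩ := hB
  have hBfin : volume B ≠ ⊤ := measure_ne_top_of_subset hBΩ hfin
  have hABfin : volume (A ∩ B) ≠ ⊤ := measure_ne_top_of_subset Set.inter_subset_right hBfin
  set m := volume (A ∩ B) ^ (1 / 2 : ℝ)
  set b := volume B ^ (1 / 2 : ℝ)
  have hm : m ≠ 0 := by simp [m, ENNReal.rpow_eq_zero_iff, hAB]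
  have hmtop : m ≠ ⊤ := by finiteness
  have hCDm : (C + D) / m ≠ ⊤ := ENNReal.div_ne_top (by finiteness) hm
  refine ⟨C + (D + (C + D) / m * b), by finiteness, fun v G h => ?_⟩
  obtain ⟨a, ha⟩ := hA v G h
  obtain ⟨c, hc⟩ := hB v G h
  set g := eLpNorm G 2 (volume.restrict Ω)
  have hv {S : Set (E d)} (hS : S ⊆ Ω) : AEStronglyMeasurable v (volume.restrict S) :=
    h.memLp.1.mono_measure (Measure.restrict_mono_set _ hS)
  have hac : ‖a - c‖ₑ ≤ (C + D) / m * g := by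
    rw [← ENNReal.mul_div_right_comm, ENNReal.le_div_iff_mul_le (.inl hm) (.inl hmtop)]
    have hinter := enorm_sub_mul_measure_rpow_le
      (hv (S := A ∩ B) (Set.inter_subset_left.trans hAΩ)) a c
    rw [Measure.restrict_apply_univ] at hinter
    calc ‖a - c‖ₑ * m ≤ _ := hinter
      _ ≤ eLpNorm (fun x => v x - a) 2 (volume.restrict A) +
          eLpNorm (fun x => v x - c) 2 (volume.restrict B) := by
          gcongr
          exacts [Set.inter_subset_left, Set.inter_subset_right]
      _ ≤ C * g + D * g := by gcongr
      _ = (C + D) * g := by ring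
  have hBa := eLpNorm_sub_const_le_add (hv hBΩ) a c
  rw [Measure.restrict_apply_univ] at hBa
  refine ⟨a, (eLpNorm_two_restrict_union_le _ _ _ _).trans ?_⟩
  calc eLpNorm (fun x => v x - a) 2 (volume.restrict A) +
        eLpNorm (fun x => v x - a) 2 (volume.restrict B)
      ≤ C * g + (D * g + (C + D) / m * g * b) := by
        gcongr
        exact hBa.trans (by gcongr)
    _ = (C + (D + (C + D) / m * b)) * g := by ring

theorem poincareOn_inter_ball (hΩ : IsOpen Ω) (hfin : volume Ω ≠ ⊤) {x e : E d} (hδ : 0 < δ)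
    (he : ∀ y ∈ Ω ∩ Metric.ball x δ, ∀ s ∈ Set.Icc (0 : ℝ) 1, y + s • e ∈ Ω)
    (hball : Metric.ball (x + e) (3 * δ) ⊆ Ω) : PoincareOn Ω (Ω ∩ Metric.ball x δ) := by
  obtain ⟨C, hC, hpoincare⟩ := poincareOn_ball hΩ.measurableSet hfin hδ hball
  refine ⟨ENNReal.ofReal ‖e‖ + C, by finiteness, fun v G h => ?_⟩
  obtain ⟨c, hc⟩ := hpoincare v G h
  set A := Ω ∩ Metric.ball x δ
  have hAe : ∀ y ∈ A, y + e ∈ Metric.ball (x + e) δ := fun y hy => by simpa using hy.2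
  have hBΩ : Metric.ball (x + e) δ ⊆ Ω := (Metric.ball_subset_ball (by linarith)).trans hball
  have hv : AEStronglyMeasurable v (volume.restrict A) :=
    h.memLp.1.mono_measure (Measure.restrict_mono_set _ Set.inter_subset_left)
  have hve : AEStronglyMeasurable (fun y => v (y + e)) (volume.restrict A) :=
    (memLp_comp_add_right hΩ.measurableSet h.memLp fun y hy => hBΩ (hAe y hy)).1
  have hsplit : (fun y => v y - c) = (fun y => v (y + e) - c) - fun y => v (y + e) - v y := by
    ext y
    simp
  refine ⟨c, ?_⟩
  calc eLpNorm (fun y => v y - c) 2 (volume.restrict A)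
      ≤ eLpNorm (fun y => v (y + e) - c) 2 (volume.restrict A) +
          eLpNorm (fun y => v (y + e) - v y) 2 (volume.restrict A) := by
        rw [hsplit]
        exact eLpNorm_sub_le (hve.sub aestronglyMeasurable_const) (hve.sub hv) one_le_two
    _ ≤ C * eLpNorm G 2 (volume.restrict Ω) +
          ENNReal.ofReal ‖e‖ * eLpNorm G 2 (volume.restrict Ω) := by
        gcongr
        · exact (eLpNorm_comp_add_right_le measurableSet_ball ((h.memLp.1.mono_measure
            (Measure.restrict_mono_set _ hBΩ)).sub aestronglyMeasurable_const) hAe 2).trans hc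
        · exact h.eLpNorm_translate_sub_le hΩ.measurableSet hfin (hΩ.inter Metric.isOpen_ball) he
    _ = _ := by ring

end Poincare

theorem isConnected_induction_of_finset_cover {X ι : Type*} [TopologicalSpace X] {Ω : Set X}
    (hΩ : IsConnected Ω) {P : Set X → Prop} {V : ι → Set X} {t : Finset ι}
    (hopen : ∀ i ∈ t, IsOpen (V i)) (hne : ∀ i ∈ t, (V i).Nonempty) (hcover : ⋃ i ∈ t, V i = Ω)
    (hP : ∀ i ∈ t, P (V i))
    (hunion : ∀ U W, P U → P W → (U ∩ W).Nonempty → P (U ∪ W)) : P Ω := by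
  classical
  have hinter {s : Finset ι} (hs : s ⊆ t) (hsne : s.Nonempty) : (Ω ∩ ⋃ i ∈ s, V i).Nonempty := by
    obtain ⟨i, hi⟩ := hsne
    obtain ⟨y, hy⟩ := hne i (hs hi)
    exact ⟨y, hcover.subset (Set.mem_biUnion (hs hi) hy), Set.mem_biUnion hi hy⟩
  obtain ⟨i₀, hi₀⟩ : t.Nonempty := by
    obtain ⟨y, hy⟩ := hΩ.nonempty
    obtain ⟨i, hi, -⟩ := Set.mem_iUnion₂.1 (hcover.superset hy)
    exact ⟨i, hi⟩
  obtain ⟨s, hs, hmax⟩ := (t.powerset.filter fun s => s.Nonempty ∧ P (⋃ i ∈ s, V i)).exists_maximal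
    ⟨{i₀}, by simp [hi₀, hP i₀ hi₀]⟩
  simp only [Finset.mem_filter, Finset.mem_powerset] at hs hmax
  obtain ⟨hst, hsne, hPs⟩ := hs
  rcases (t \ s).eq_empty_or_nonempty with hempty | hrest
  · rwa [hst.antisymm (Finset.sdiff_eq_empty_iff_subset.1 hempty), hcover] at hPs
  obtain ⟨y, -, hys, hyrest⟩ := hΩ.isPreconnected (⋃ i ∈ s, V i) (⋃ i ∈ t \ s, V i)
    (isOpen_biUnion fun i hi => hopen i (hst hi))
    (isOpen_biUnion fun i hi => hopen i (Finset.sdiff_subset hi))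
    (by rw [← hcover, ← Finset.set_biUnion_union, Finset.union_sdiff_of_subset hst])
    (hinter hst hsne) (hinter Finset.sdiff_subset hrest)
  obtain ⟨i, hi, hyi⟩ := Set.mem_iUnion₂.1 hyrest
  obtain ⟨hit, his⟩ := Finset.mem_sdiff.1 hi
  have hPinsert : P (⋃ j ∈ insert i s, V j) := by
    rw [Finset.set_biUnion_insert]
    exact hunion _ _ (hP i hit) hPs ⟨y, hyi, hys⟩
  exact absurd (hmax ⟨Finset.insert_subset hit hst, Finset.insert_nonempty i s, hPinsert⟩
    (Finset.subset_insert i s) (Finset.mem_insert_self i s)) his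

/-- Every point of the closure has a neighbourhood whose part in `Ω` can be moved, inside `Ω`, into
a ball that lies well within `Ω`. This is the regularity of the boundary behind the Poincaré
inequality. -/
def IsLocallyShiftable (Ω : Set (E d)) : Prop :=
  ∀ x ∈ closure Ω, ∃ δ > 0, ∃ e : E d,
    (∀ y ∈ Ω ∩ Metric.ball x δ, ∀ s ∈ Set.Icc (0 : ℝ) 1, y + s • e ∈ Ω) ∧
      Metric.ball (x + e) (3 * δ) ⊆ Ω

theorem IsLocallyShiftable.poincareOn {Ω : Set (E d)} (h : IsLocallyShiftable Ω) (hΩ : IsOpen Ω)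
    (hconn : IsConnected Ω) (hbdd : Bornology.IsBounded Ω) : PoincareOn Ω Ω := by
  have hfin : volume Ω ≠ ⊤ := hbdd.measure_lt_top.ne
  choose! δ hδ e hshift hball using h
  obtain ⟨t, ht, hcover⟩ := hbdd.isCompact_closure.elim_nhds_subcover
    (fun x => Metric.ball x (δ x)) fun x hx => Metric.ball_mem_nhds x (hδ x hx)
  suffices Ω ⊆ Ω ∧ IsOpen Ω ∧ PoincareOn Ω Ω from this.2.2
  refine isConnected_induction_of_finset_cover hconn
    (P := fun U => U ⊆ Ω ∧ IsOpen U ∧ PoincareOn Ω U) (V := fun x => Ω ∩ Metric.ball x (δ x))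
    (t := t) (fun x _ => hΩ.inter Metric.isOpen_ball) (fun x hx => ?_) ?_ (fun x hx => ?_) ?_
  · rw [Set.inter_comm]
    exact mem_closure_iff.1 (ht x hx) _ Metric.isOpen_ball (Metric.mem_ball_self (hδ x (ht x hx)))
  · rw [← Set.inter_iUnion₂, Set.inter_eq_left]
    exact subset_closure.trans hcover
  · have hx := ht x hx
    exact ⟨Set.inter_subset_left, hΩ.inter Metric.isOpen_ball,
      poincareOn_inter_ball hΩ hfin (hδ x hx) (hshift x hx) (hball x hx)⟩
  · rintro U W ⟨hUΩ, hU, hPU⟩ ⟨hWΩ, hW, hPW⟩ hUW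
    exact ⟨Set.union_subset hUΩ hWΩ, hU.union hW,
      hPU.union hPW hUΩ hWΩ hfin ((hU.inter hW).measure_pos volume hUW).ne'⟩

theorem isLocallyShiftable_of_convex {Ω : Set (E d)} (hΩ : IsOpen Ω) (hconv : Convex ℝ Ω)
    (hne : Ω.Nonempty) : IsLocallyShiftable Ω := by
  obtain ⟨c, hc⟩ := hne
  obtain ⟨r, hr, hball⟩ := Metric.isOpen_iff.1 hΩ c hc
  refine fun x _ => ⟨r / 3, by positivity, c - x, fun y hy s hs => ?_, ?_⟩
  · refine hconv.add_smul_mem hy.1 (hball ?_) hs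
    have hyx := Metric.mem_ball.1 hy.2
    rw [dist_eq_norm] at hyx
    rw [Metric.mem_ball, dist_eq_norm, add_sub_left_comm, add_sub_cancel_left]
    linarith
  · rwa [add_sub_cancel, mul_div_cancel₀ r three_ne_zero]

theorem eventually_lt_of_hasStrictFDerivAt {V : Type*} [NormedAddCommGroup V] [NormedSpace ℝ V]
    {r : V → ℝ} {L : V →L[ℝ] ℝ} {x e : V} (hr : HasStrictFDerivAt r L x) (he : L e < 0) :
    ∀ᶠ p : V × ℝ in 𝓝 (x, 0), 0 < p.2 → r (p.1 + p.2 • e) < r p.1 := by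
  have he_pos : 0 < ‖e‖ := norm_pos_iff.2 fun h => by simp [h] at he
  have hc : 0 < -L e / (2 * ‖e‖) := div_pos (neg_pos.2 he) (by positivity)
  have htendsto : Tendsto (fun p : V × ℝ => (p.1 + p.2 • e, p.1)) (𝓝 (x, 0)) (𝓝 (x, x)) :=
    Continuous.tendsto' (by fun_prop) _ _ (by simp)
  filter_upwards [htendsto.eventually (hr.isLittleO.def hc)] with p hp hpos
  rw [add_sub_cancel_left, norm_smul, map_smul, Real.norm_of_nonneg hpos.le, smul_eq_mul,
    Real.norm_eq_abs] at hp
  have hbound : -L e / (2 * ‖e‖) * (p.2 * ‖e‖) = -(p.2 * L e) / 2 := by field_simp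
  have hneg : p.2 * L e < 0 := mul_neg_of_pos_of_neg hpos he
  linarith [(abs_le.1 hp).2]

theorem HasC2Boundary.exists_inward_direction {Ω : Set (E d)} (hΩ : HasC2Boundary Ω) {x : E d}
    (hx : x ∈ frontier Ω) :
    ∃ e : E d, ∀ᶠ p : E d × ℝ in 𝓝 (x, 0),
      0 < p.2 → p.1 ∈ closure Ω → p.1 + p.2 • e ∈ Ω := by
  obtain ⟨U, hU, r, hr, hdr, hUr⟩ := hΩ x hx
  obtain ⟨e, he⟩ : ∃ e, fderiv ℝ r x e < 0 := by
    obtain ⟨e, he⟩ := DFunLike.ne_iff.1 hdr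
    rcases lt_or_gt_of_ne he with hneg | hpos
    · exact ⟨e, hneg⟩
    · exact ⟨-e, by simpa using hpos⟩
  have hmem {y : E d} (hy : y ∈ U) : y ∈ Ω ↔ r y < 0 := by
    have : y ∈ Ω ∩ U ↔ y ∈ {y | r y < 0} ∩ U := by rw [hUr]
    simpa [hy] using this
  have hclosure : closure Ω ∩ interior U ⊆ {y | r y ≤ 0} :=
    isOpen_interior.closure_inter.trans <| closure_minimal
      (fun y hy => ((hmem (interior_subset hy.2)).1 hy.1).le)
      (isClosed_le hr.continuous continuous_const)
  have hshift : Tendsto (fun p : E d × ℝ => p.1 + p.2 • e) (𝓝 (x, 0)) (𝓝 x) :=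
    Continuous.tendsto' (by fun_prop) _ _ (by simp)
  refine ⟨e, ?_⟩
  filter_upwards [eventually_lt_of_hasStrictFDerivAt
      (hr.contDiffAt.hasStrictFDerivAt two_ne_zero) he,
    (continuous_fst.tendsto (x, (0 : ℝ))).eventually (interior_mem_nhds.2 hU),
    hshift.eventually hU] with p hlt hp hpe hpos hcl
  exact (hmem hpe).2 ((hlt hpos).trans_le (hclosure ⟨hcl, hp⟩))

theorem HasC2Boundary.isLocallyShiftable {Ω : Set (E d)} (hC2 : HasC2Boundary Ω)
    (hΩ : IsOpen Ω) : IsLocallyShiftable Ω := by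
  intro x hx
  by_cases hxΩ : x ∈ Ω
  · obtain ⟨r, hr, hball⟩ := Metric.isOpen_iff.1 hΩ x hxΩ
    refine ⟨r / 3, by positivity, 0, fun y hy s _ => by simpa using hy.1, ?_⟩
    rwa [add_zero, mul_div_cancel₀ r three_ne_zero]
  obtain ⟨e, he⟩ := hC2.exists_inward_direction ⟨hx, by rwa [hΩ.interior_eq]⟩
  obtain ⟨η, hη, hshift⟩ := Metric.eventually_nhds_iff_ball.1 he
  have hmove {y : E d} (hy : y ∈ closure Ω) (hyx : y ∈ Metric.ball x η) {s : ℝ} (hs : 0 < s)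
      (hsη : s ≤ η / 2) : y + s • e ∈ Ω :=
    hshift (y, s) (by
      rw [← ball_prod_same, Set.mem_prod, mem_ball_zero_iff, Real.norm_of_nonneg hs.le]
      exact ⟨hyx, by linarith⟩) hs hy
  obtain ⟨q, hq, hball⟩ := Metric.isOpen_iff.1 hΩ _
    (hmove hx (Metric.mem_ball_self hη) (half_pos hη) le_rfl)
  refine ⟨min (q / 3) η, by positivity, (η / 2) • e, fun y hy s hs => ?_, ?_⟩
  · rcases hs.1.eq_or_lt with rfl | hspos
    · simpa using hy.1
    rw [smul_smul]
    exact hmove (subset_closure hy.1) (Metric.ball_subset_ball (min_le_right _ _) hy.2)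
      (by positivity) (mul_le_of_le_one_left (by positivity) hs.2)
  · exact (Metric.ball_subset_ball (by linarith [min_le_left (q / 3) η])).trans hball

theorem BoundaryCondition.IsDomain.poincareOn {bc : BoundaryCondition} {Ω : Set (E d)}
    (hΩ : bc.IsDomain Ω) : PoincareOn Ω Ω := by
  cases bc with
  | neumann =>
    obtain ⟨hopen, hconn, hbdd, hC2⟩ := hΩ
    exact (hC2.isLocallyShiftable hopen).poincareOn hopen hconn hbdd
  | periodic L =>
    obtain ⟨hL, rfl⟩ := hΩ
    have hne := openCube_nonempty (d := d) hL
    exact (isLocallyShiftable_of_convex (isOpen_openCube L) (convex_openCube L) hne).poincareOn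
      (isOpen_openCube L) ⟨hne, (convex_openCube L).isPreconnected⟩ (isBounded_openCube L)

/-! ### Deviation from the mean -/

theorem integral_mul_sub_const {X : Type*} [MeasurableSpace X] {μ : Measure X} [IsFiniteMeasure μ]
    {g χ : X → ℝ} (hg : MemLp g 2 μ) (hmean : ∫ x, g x ∂μ = 0) (hχ : MemLp χ 2 μ) (c : ℝ) :
    ∫ x, g x * (χ x - c) ∂μ = ∫ x, g x * χ x ∂μ := by
  simp only [mul_sub]
  rw [integral_sub (integrable_mul hg hχ) ((hg.integrable one_le_two).mul_const c),
    integral_mul_const, hmean, zero_mul, sub_zero]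

section Fluct

variable {Ω : Set (E d)} {v : E d → ℝ} [IsFiniteMeasure (volume.restrict Ω)]

theorem memLp_fluct (hv : MemLp v 2 (volume.restrict Ω)) :
    MemLp (fluct Ω v) 2 (volume.restrict Ω) :=
  hv.sub (memLp_const _)

theorem integral_fluct (v : E d → ℝ) : ∫ x in Ω, fluct Ω v x = 0 := by
  have hmean : mean Ω v = ⨍ x in Ω, v x := by
    rw [setAverage_eq, mean, smul_eq_mul, div_eq_inv_mul]
  simp only [fluct, hmean]
  exact integral_sub_average _ _

theorem integral_mul_fluct {g : E d → ℝ} (hg : MemLp g 2 (volume.restrict Ω))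
    (hmean : ∫ x in Ω, g x = 0) (hv : MemLp v 2 (volume.restrict Ω)) :
    ∫ x in Ω, g x * fluct Ω v x = ∫ x in Ω, g x * v x :=
  integral_mul_sub_const hg hmean hv (mean Ω v)

theorem norm_fluct_sq_eq (hv : MemLp v 2 (volume.restrict Ω)) :
    (eLpNorm (fluct Ω v) 2 (volume.restrict Ω)).toReal ^ 2 = ∫ x in Ω, fluct Ω v x * v x := by
  rw [← integral_mul_self_eq_sq (memLp_fluct hv),
    integral_mul_fluct (memLp_fluct hv) (integral_fluct v) hv]

theorem norm_fluct_le (hv : MemLp v 2 (volume.restrict Ω)) (c : ℝ) :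
    (eLpNorm (fluct Ω v) 2 (volume.restrict Ω)).toReal ≤
      (eLpNorm (fun x => v x - c) 2 (volume.restrict Ω)).toReal := by
  have hsq := norm_fluct_sq_eq hv
  rw [← integral_mul_sub_const (memLp_fluct hv) (integral_fluct v) hv c] at hsq
  have hcauchy := hsq.le.trans <| (le_abs_self _).trans <|
    abs_integral_mul_le (memLp_fluct hv) (hv.sub (memLp_const c))
  rw [sq] at hcauchy
  refine le_of_not_gt fun hlt => hcauchy.not_gt (mul_lt_mul_of_pos_left hlt ?_)
  exact ENNReal.toReal_nonneg.trans_lt hlt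

theorem PoincareOn.exists_norm_fluct_le (hΩ : PoincareOn Ω Ω) :
    ∃ C : ℝ, 0 < C ∧ ∀ (v : E d → ℝ) (G : E d → E d), IsWeakGradient Ω v G →
      (eLpNorm (fluct Ω v) 2 (volume.restrict Ω)).toReal ≤
        C * (eLpNorm G 2 (volume.restrict Ω)).toReal := by
  obtain ⟨C, hC, h⟩ := hΩ
  refine ⟨C.toReal + 1, by positivity, fun v G hG => ?_⟩
  obtain ⟨c, hc⟩ := h v G hG
  calc (eLpNorm (fluct Ω v) 2 (volume.restrict Ω)).toReal
      ≤ (eLpNorm (fun x => v x - c) 2 (volume.restrict Ω)).toReal := norm_fluct_le hG.memLp c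
    _ ≤ C.toReal * (eLpNorm G 2 (volume.restrict Ω)).toReal := by
        rw [← ENNReal.toReal_mul]
        exact ENNReal.toReal_mono (ENNReal.mul_ne_top hC hG.memLp_grad.2.ne) hc
    _ ≤ _ := by gcongr; exact le_add_of_nonneg_right zero_le_one

end Fluct

/-! ### The dual norm -/

namespace BoundaryCondition

variable {bc : BoundaryCondition} {Ω : Set (E d)} {g g' w χ : E d → ℝ} {W X : E d → E d}
  {γ κ S : ℝ}

theorem negNorm_le_ofReal {M : ℝ} (hM : 0 ≤ M)
    (h : ∀ χ X, bc.HasGradient Ω χ X →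
      |∫ x in Ω, g x * χ x| ≤ M * (eLpNorm X 2 (volume.restrict Ω)).toReal) :
    bc.negNorm Ω g ≤ ENNReal.ofReal M := by
  refine iSup_le fun χ => iSup_le fun X => iSup_le fun hX => ENNReal.div_le_of_le_mul ?_
  rw [← ENNReal.ofReal_toReal hX.memLp_grad.2.ne, ← ENNReal.ofReal_mul hM]
  exact ENNReal.ofReal_le_ofReal (h χ X hX)

theorem abs_integral_mul_le_negNorm_mul (hg : bc.negNorm Ω g ≠ ⊤) (hX : bc.HasGradient Ω χ X) :
    |∫ x in Ω, g x * χ x| ≤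
      (bc.negNorm Ω g).toReal * (eLpNorm X 2 (volume.restrict Ω)).toReal := by
  have hle : ENNReal.ofReal |∫ x in Ω, g x * χ x| / eLpNorm X 2 (volume.restrict Ω) ≤
      bc.negNorm Ω g :=
    le_iSup_of_le χ (le_iSup_of_le X (le_iSup_of_le hX le_rfl))
  rw [ENNReal.div_le_iff_le_mul (.inr hg) (.inl hX.memLp_grad.2.ne)] at hle
  rw [← ENNReal.toReal_mul]
  exact (ENNReal.ofReal_le_iff_le_toReal (ENNReal.mul_ne_top hg hX.memLp_grad.2.ne)).1 hle

theorem two_mul_integral_sub_sq_le (hg : bc.negNorm Ω g ≠ ⊤) (hX : bc.HasGradient Ω χ X) :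
    2 * (∫ x in Ω, g x * χ x) - (eLpNorm X 2 (volume.restrict Ω)).toReal ^ 2 ≤
      (bc.negNorm Ω g).toReal ^ 2 := by
  have hbound := (le_abs_self _).trans (abs_integral_mul_le_negNorm_mul hg hX)
  linarith [two_mul_le_add_sq (bc.negNorm Ω g).toReal (eLpNorm X 2 (volume.restrict Ω)).toReal]

theorem negNorm_le_ofReal_sqrt (h : ∀ χ X, bc.HasGradient Ω χ X →
      2 * (∫ x in Ω, g x * χ x) - (eLpNorm X 2 (volume.restrict Ω)).toReal ^ 2 ≤ S) :
    bc.negNorm Ω g ≤ ENNReal.ofReal √S := by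
  refine negNorm_le_ofReal (Real.sqrt_nonneg S) fun χ X hX => ?_
  set b := ∫ x in Ω, g x * χ x with hb
  have hξ_nonneg : 0 ≤ (eLpNorm X 2 (volume.restrict Ω)).toReal := ENNReal.toReal_nonneg
  set ξ := (eLpNorm X 2 (volume.restrict Ω)).toReal with hξ
  have hquad : ∀ s : ℝ, 0 ≤ ξ ^ 2 * (s * s) + -(2 * b) * s + S := fun s => by
    have hs := h _ _ (hX.const_smul s)
    simp only [Pi.smul_apply, smul_eq_mul, mul_left_comm (g _), integral_const_mul,
      eLpNorm_const_smul, ENNReal.toReal_mul, toReal_enorm, mul_pow, Real.norm_eq_abs, sq_abs,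
      ← hb, ← hξ] at hs
    linarith
  have hdiscrim := discrim_le_zero hquad
  rw [discrim] at hdiscrim
  rw [← Real.sqrt_sq hξ_nonneg, ← Real.sqrt_mul' _ (sq_nonneg ξ)]
  exact Real.abs_le_sqrt (by linarith)

theorem negNorm_sq_add_le_of_implicit_step (hΩ : Bornology.IsBounded Ω)
    (hg : MemLp g 2 (volume.restrict Ω)) (hfin : bc.negNorm Ω g ≠ ⊤)
    (hW : bc.HasGradient Ω w W)
    (hstep : ∀ χ X, bc.HasGradient Ω χ X →
      ∫ x in Ω, g' x * χ x = (∫ x in Ω, g x * χ x) - κ * ∫ x in Ω, inner ℝ (W x) (X x)) :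
    bc.negNorm Ω g' ≠ ⊤ ∧
      (bc.negNorm Ω g').toReal ^ 2 + 2 * κ * (∫ x in Ω, g' x * w x) ≤
        (bc.negNorm Ω g).toReal ^ 2 := by
  set S := (bc.negNorm Ω g).toReal ^ 2 - 2 * κ * ∫ x in Ω, g' x * w x
  have hfenchel : ∀ χ X, bc.HasGradient Ω χ X →
      2 * (∫ x in Ω, g' x * χ x) - (eLpNorm X 2 (volume.restrict Ω)).toReal ^ 2 ≤ S := by
    intro χ X hX
    have htest := two_mul_integral_sub_sq_le hfin (hX.add hΩ (hW.const_smul κ))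
    rw [toReal_eLpNorm_add_smul_sq hX.memLp_grad hW.memLp_grad] at htest
    have hsplit : ∫ x in Ω, g x * (χ + κ • w) x =
        (∫ x in Ω, g x * χ x) + κ * ∫ x in Ω, g x * w x := by
      simp only [Pi.add_apply, Pi.smul_apply, smul_eq_mul, mul_add, mul_left_comm (g _)]
      rw [integral_add (integrable_mul hg hX.memLp) ((integrable_mul hg hW.memLp).const_mul κ),
        integral_const_mul]
    have hχ := hstep χ X hX
    have hw := hstep w W hW
    rw [integral_inner_self_eq_sq hW.memLp_grad] at hw
    have hcomm : ∫ x in Ω, inner ℝ (X x) (W x) = ∫ x in Ω, inner ℝ (W x) (X x) := by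
      simp only [real_inner_comm]
    rw [hsplit, hcomm] at htest
    have hκw := congrArg (κ * ·) hw
    linear_combination htest + 2 * hχ + 2 * hκw +
      sq_nonneg (κ * (eLpNorm W 2 (volume.restrict Ω)).toReal)
  have hS_nonneg : 0 ≤ S := by simpa using hfenchel _ _ (hW.const_smul 0)
  have hle := negNorm_le_ofReal_sqrt hfenchel
  refine ⟨ne_top_of_le_ne_top ENNReal.ofReal_ne_top hle, ?_⟩
  have hle_real := ENNReal.toReal_le_of_le_ofReal (Real.sqrt_nonneg S) hle
  have hsq := (Real.le_sqrt ENNReal.toReal_nonneg hS_nonneg).1 hle_real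
  linarith

theorem exists_isGamma [IsFiniteMeasure (volume.restrict Ω)] (bc : BoundaryCondition)
    (hΩ : PoincareOn Ω Ω) : ∃ γ : ℝ, bc.IsGamma Ω γ := by
  obtain ⟨C, hC, h⟩ := hΩ.exists_norm_fluct_le
  refine ⟨C ^ 2, by positivity, fun v G hG => ?_⟩
  rw [← ENNReal.ofReal_toReal hG.memLp_grad.2.ne, ← ENNReal.ofReal_mul (by positivity)]
  refine negNorm_le_ofReal (by positivity) fun χ X hX => ?_
  rw [← integral_mul_fluct (memLp_fluct hG.memLp) (integral_fluct v) hX.memLp]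
  calc |∫ x in Ω, fluct Ω v x * fluct Ω χ x|
      ≤ (eLpNorm (fluct Ω v) 2 (volume.restrict Ω)).toReal *
          (eLpNorm (fluct Ω χ) 2 (volume.restrict Ω)).toReal :=
        abs_integral_mul_le (memLp_fluct hG.memLp) (memLp_fluct hX.memLp)
    _ ≤ (C * (eLpNorm G 2 (volume.restrict Ω)).toReal) *
          (C * (eLpNorm X 2 (volume.restrict Ω)).toReal) := by
        gcongr
        exacts [h v G hG.isWeakGradient, h χ X hX.isWeakGradient]
    _ = _ := by ring

theorem IsGamma.toReal_negNorm_le (hγ : bc.IsGamma Ω γ) (hX : bc.HasGradient Ω χ X) :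
    (bc.negNorm Ω (fluct Ω χ)).toReal ≤ γ * (eLpNorm X 2 (volume.restrict Ω)).toReal := by
  have h := hγ.2 χ X hX
  rw [← ENNReal.ofReal_toReal hX.memLp_grad.2.ne, ← ENNReal.ofReal_mul hγ.1.le] at h
  exact ENNReal.toReal_le_of_le_ofReal (mul_nonneg hγ.1.le ENNReal.toReal_nonneg) h

theorem IsGamma.norm_fluct_sq_le [IsFiniteMeasure (volume.restrict Ω)] (hγ : bc.IsGamma Ω γ)
    (hX : bc.HasGradient Ω χ X) :
    (eLpNorm (fluct Ω χ) 2 (volume.restrict Ω)).toReal ^ 2 ≤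
      γ * (eLpNorm X 2 (volume.restrict Ω)).toReal ^ 2 := by
  have hfin : bc.negNorm Ω (fluct Ω χ) ≠ ⊤ :=
    ne_top_of_le_ne_top (ENNReal.mul_ne_top ENNReal.ofReal_ne_top hX.memLp_grad.2.ne)
      (hγ.2 χ X hX)
  calc (eLpNorm (fluct Ω χ) 2 (volume.restrict Ω)).toReal ^ 2
      = ∫ x in Ω, fluct Ω χ x * χ x := norm_fluct_sq_eq hX.memLp
    _ ≤ (bc.negNorm Ω (fluct Ω χ)).toReal * (eLpNorm X 2 (volume.restrict Ω)).toReal :=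
        (le_abs_self _).trans (abs_integral_mul_le_negNorm_mul hfin hX)
    _ ≤ γ * (eLpNorm X 2 (volume.restrict Ω)).toReal *
          (eLpNorm X 2 (volume.restrict Ω)).toReal := by
        gcongr
        exact hγ.toReal_negNorm_le hX
    _ = _ := by ring

theorem IsGamma.negNorm_ne_top [IsFiniteMeasure (volume.restrict Ω)] (hγ : bc.IsGamma Ω γ)
    (hg : MemLp g 2 (volume.restrict Ω)) (hmean : ∫ x in Ω, g x = 0) : bc.negNorm Ω g ≠ ⊤ := by
  refine ne_top_of_le_ne_top ENNReal.ofReal_ne_top (negNorm_le_ofReal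
    (M := (eLpNorm g 2 (volume.restrict Ω)).toReal * √γ) (by positivity) fun χ X hX => ?_)
  rw [← integral_mul_fluct hg hmean hX.memLp, mul_assoc]
  refine (abs_integral_mul_le hg (memLp_fluct hX.memLp)).trans ?_
  gcongr
  rw [← Real.sqrt_sq (ENNReal.toReal_nonneg (a := eLpNorm X 2 (volume.restrict Ω))),
    ← Real.sqrt_mul hγ.1.le]
  exact Real.le_sqrt_of_sq_le (hγ.norm_fluct_sq_le hX)

end BoundaryCondition

/-! ### Dissipativity of the nonlinearity -/

/-- `f` is dissipative relative to averages `m` with `|m| ≤ α`: the product `(v - m) f(v)` is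
bounded below by `-K`, which is what controls the nonlinear term in the energy estimate. -/
def IsDissipative (f : ℝ → ℝ) (α K : ℝ) : Prop :=
  ∀ m v, |m| ≤ α → -K ≤ (v - m) * f v

theorem IsDissipative.nonneg {f : ℝ → ℝ} {α K : ℝ} (h : IsDissipative f α K) (hα : 0 ≤ α) :
    0 ≤ K := by
  simpa using h 0 0 (by simpa using hα)

theorem IsDissipative.neg_le_integral {f : ℝ → ℝ} {α K : ℝ} (h : IsDissipative f α K)
    {Ω : Set (E d)} [IsFiniteMeasure (volume.restrict Ω)] {u : E d → ℝ}
    (hu : MemLp u 2 (volume.restrict Ω)) (hfu : MemLp (fun x => f (u x)) 2 (volume.restrict Ω))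
    (hm : |mean Ω u| ≤ α) : -(K * volume.real Ω) ≤ ∫ x in Ω, fluct Ω u x * f (u x) :=
  calc -(K * volume.real Ω) = ∫ _ in Ω, -K := by rw [setIntegral_const, smul_eq_mul]; ring
    _ ≤ _ := integral_mono (integrable_const _) (integrable_mul (memLp_fluct hu) hfu)
        fun x => h _ (u x) hm

namespace Nonlinearity

variable {f F : ℝ → ℝ} {p c₀ c₁ c₃ : ℝ} {c₂ : ℝ → ℝ}

theorem c₃_nonneg (h : Nonlinearity d f F p c₀ c₁ c₂ c₃) : 0 ≤ c₃ := by
  have hlower := h.lower 0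
  rw [abs_zero, Real.zero_rpow (by linarith [h.two_le]), h.primitive_zero] at hlower
  linarith

theorem mul_le_of_abs_le (h : Nonlinearity d f F p c₀ c₁ c₂ c₃) {α m : ℝ} (hm : |m| ≤ α) (v : ℝ) :
    m * f v ≤ (p - 3 / 2) * (c₀ * |v| ^ (2 * p)) + c₂ ((p - 3 / 2) / α) * α := by
  have hp : 0 < p - 3 / 2 := by linarith [h.two_le]
  have hV : 0 ≤ c₀ * |v| ^ (2 * p) := mul_nonneg h.c₀_pos.le (by positivity)
  rcases ((abs_nonneg m).trans hm).eq_or_lt with rfl | hα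
  · rw [abs_nonpos_iff.1 hm]
    linarith [mul_nonneg hp.le hV]
  calc m * f v ≤ |m| * |f v| := (le_abs_self _).trans (abs_mul _ _).le
    _ ≤ α * ((p - 3 / 2) / α * c₀ * |v| ^ (2 * p) + c₂ ((p - 3 / 2) / α)) :=
        mul_le_mul hm (h.growth _ (div_pos hp hα) v) (abs_nonneg _) hα.le
    _ = _ := by field_simp

theorem isDissipative (h : Nonlinearity d f F p c₀ c₁ c₂ c₃) (α : ℝ) :
    IsDissipative f α (c₁ + c₂ ((p - 3 / 2) / α) * α + 2 * c₃) := by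
  intro m v hm
  have hV : 0 ≤ c₀ * |v| ^ (2 * p) := mul_nonneg h.c₀_pos.le (by positivity)
  linarith [h.coercive v, h.mul_le_of_abs_le hm v, h.c₃_nonneg]

end Nonlinearity

/-! ### One step of the scheme -/

namespace BoundaryCondition

/-- One step of length `κ` of the implicit Euler scheme, from `u` to `u'`. -/
def IsEulerStep (bc : BoundaryCondition) (Ω : Set (E d)) (ε : ℝ) (f : ℝ → ℝ) (κ : ℝ)
    (u u' : E d → ℝ) : Prop :=
  ∃ Au w Aw : E d → ℝ,
    bc.IsNegLaplacian Ω u' Au ∧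
    (w =ᵐ[volume.restrict Ω] fun x => ε * Au x + f (u' x)) ∧
    bc.IsNegLaplacian Ω w Aw ∧
    ∀ᵐ x ∂(volume.restrict Ω), (u' x - u x) / κ + Aw x = 0

variable {bc : BoundaryCondition} {Ω : Set (E d)}

section NegLaplacian

variable {v g : E d → ℝ}

theorem IsNegLaplacian.memLp (h : bc.IsNegLaplacian Ω v g) : MemLp v 2 (volume.restrict Ω) := by
  obtain ⟨G, H, hG, -⟩ := h
  exact hG.memLp

theorem IsNegLaplacian.memLp_right (h : bc.IsNegLaplacian Ω v g) :
    MemLp g 2 (volume.restrict Ω) := by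
  obtain ⟨G, H, -, hH, hg, -⟩ := h
  exact (memLp_congr_ae hg).2
    (memLp_finsetSum _ fun i _ => memLp_coord (hH i).memLp_grad i).neg

theorem IsNegLaplacian.exists_green (h : bc.IsNegLaplacian Ω v g) :
    ∃ G, bc.HasGradient Ω v G ∧ ∀ χ X, bc.HasGradient Ω χ X →
      ∫ x in Ω, inner ℝ (G x) (X x) = ∫ x in Ω, g x * χ x := by
  obtain ⟨G, H, hG, -, -, hgreen⟩ := h
  exact ⟨G, hG, hgreen⟩

theorem IsNegLaplacian.integral_eq_zero (h : bc.IsNegLaplacian Ω v g)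
    (hΩ : bc.HasGradient Ω 1 0) : ∫ x in Ω, g x = 0 := by
  obtain ⟨G, -, hgreen⟩ := h.exists_green
  simpa using (hgreen 1 0 hΩ).symm

end NegLaplacian

section Step

variable {γ ε κ α K : ℝ} {f : ℝ → ℝ} {u u' Au w Aw : E d → ℝ}

theorem IsEulerStep.memLp (h : bc.IsEulerStep Ω ε f κ u u') : MemLp u' 2 (volume.restrict Ω) := by
  obtain ⟨Au, w, Aw, hAu, -⟩ := h
  exact hAu.memLp

theorem ae_eq_of_step (hκ : κ ≠ 0)
    (h : ∀ᵐ x ∂(volume.restrict Ω), (u' x - u x) / κ + Aw x = 0) :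
    u' =ᵐ[volume.restrict Ω] fun x => u x - κ * Aw x := by
  filter_upwards [h] with x hx
  field_simp at hx
  linarith

variable [IsFiniteMeasure (volume.restrict Ω)]

theorem IsEulerStep.mean_eq (hΩ : bc.HasGradient Ω 1 0) (hκ : κ ≠ 0)
    (hu : MemLp u 2 (volume.restrict Ω)) (h : bc.IsEulerStep Ω ε f κ u u') :
    mean Ω u' = mean Ω u := by
  obtain ⟨Au, w, Aw, -, -, hAw, hstep⟩ := h
  rw [mean, integral_congr_ae (ae_eq_of_step hκ hstep),
    integral_sub (hu.integrable one_le_two)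
      ((hAw.memLp_right.integrable one_le_two).const_mul κ),
    integral_const_mul, hAw.integral_eq_zero hΩ, mul_zero, sub_zero, mean]

theorem le_integral_fluct_mul_potential (hΩ : bc.HasGradient Ω 1 0) (hf : IsDissipative f α K)
    (hm : |mean Ω u| ≤ α) (hAu : bc.IsNegLaplacian Ω u Au)
    (hw : w =ᵐ[volume.restrict Ω] fun x => ε * Au x + f (u x))
    (hw_memLp : MemLp w 2 (volume.restrict Ω)) :
    ∃ G, bc.HasGradient Ω u G ∧
      ε * (eLpNorm G 2 (volume.restrict Ω)).toReal ^ 2 - K * volume.real Ω ≤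
        ∫ x in Ω, fluct Ω u x * w x := by
  obtain ⟨G, hG, hgreen⟩ := hAu.exists_green
  refine ⟨G, hG, ?_⟩
  have hfluct := memLp_fluct hAu.memLp
  have hfu : MemLp (fun x => f (u x)) 2 (volume.restrict Ω) := by
    refine (memLp_congr_ae ?_).1 (hw_memLp.sub (hAu.memLp_right.const_mul ε))
    filter_upwards [hw] with x hx
    simp [hx]
  have henergy : ∫ x in Ω, Au x * fluct Ω u x = (eLpNorm G 2 (volume.restrict Ω)).toReal ^ 2 := by
    rw [integral_mul_fluct hAu.memLp_right (hAu.integral_eq_zero hΩ) hAu.memLp, ← hgreen u G hG,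
      integral_inner_self_eq_sq hG.memLp_grad]
  have hsplit : ∫ x in Ω, fluct Ω u x * w x =
      ε * (∫ x in Ω, Au x * fluct Ω u x) + ∫ x in Ω, fluct Ω u x * f (u x) := by
    rw [← integral_const_mul, ← integral_add
      ((integrable_mul hAu.memLp_right hfluct).const_mul ε) (integrable_mul hfluct hfu)]
    refine integral_congr_ae ?_
    filter_upwards [hw] with x hx
    rw [hx]
    ring
  rw [hsplit, henergy]
  linarith [hf.neg_le_integral hAu.memLp hfu hm]

theorem integral_fluct_mul_of_step (hmean : mean Ω u' = mean Ω u) (hκ : κ ≠ 0)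
    (hu : MemLp u 2 (volume.restrict Ω)) (hAw : MemLp Aw 2 (volume.restrict Ω))
    (h : ∀ᵐ x ∂(volume.restrict Ω), (u' x - u x) / κ + Aw x = 0)
    {χ : E d → ℝ} (hχ : MemLp χ 2 (volume.restrict Ω)) :
    ∫ x in Ω, fluct Ω u' x * χ x =
      (∫ x in Ω, fluct Ω u x * χ x) - κ * ∫ x in Ω, Aw x * χ x := by
  rw [← integral_const_mul, ← integral_sub (integrable_mul (memLp_fluct hu) hχ)
    ((integrable_mul hAw hχ).const_mul κ)]
  refine integral_congr_ae ?_
  filter_upwards [ae_eq_of_step hκ h] with x hx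
  simp only [fluct, hmean, hx]
  ring

theorem IsEulerStep.negNorm_sq_mul_le (hΩ : bc.IsAdmissible Ω) (hγ : bc.IsGamma Ω γ)
    (hε : 0 ≤ ε) (hκ : 0 < κ) (hf : IsDissipative f α K) (hu : MemLp u 2 (volume.restrict Ω))
    (hm : |mean Ω u| ≤ α) (h : bc.IsEulerStep Ω ε f κ u u') :
    (bc.negNorm Ω (fluct Ω u')).toReal ^ 2 * (γ ^ 2 + ε * κ) ≤
      γ ^ 2 * ((bc.negNorm Ω (fluct Ω u)).toReal ^ 2 + 2 * κ * (K * volume.real Ω)) := by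
  have hmean := h.mean_eq hΩ.hasGradient_one hκ.ne' hu
  obtain ⟨Au, w, Aw, hAu, hw, hAw, hstep⟩ := h
  obtain ⟨W, hW, hgreen⟩ := hAw.exists_green
  have hdual := (negNorm_sq_add_le_of_implicit_step hΩ.isBounded (memLp_fluct hu)
    (hγ.negNorm_ne_top (memLp_fluct hu) (integral_fluct u)) hW fun χ X hX => by
      rw [hgreen χ X hX, integral_fluct_mul_of_step hmean hκ.ne' hu hAw.memLp_right hstep
        hX.memLp]).2
  obtain ⟨G, hG, hpotential⟩ := le_integral_fluct_mul_potential hΩ.hasGradient_one hf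
    (hmean ▸ hm) hAu hw hAw.memLp
  have hgradient : (bc.negNorm Ω (fluct Ω u')).toReal ^ 2 ≤
      γ ^ 2 * (eLpNorm G 2 (volume.restrict Ω)).toReal ^ 2 := by
    rw [← mul_pow]
    exact pow_le_pow_left₀ ENNReal.toReal_nonneg (hγ.toReal_negNorm_le hG) 2
  set N := (bc.negNorm Ω (fluct Ω u)).toReal
  set N' := (bc.negNorm Ω (fluct Ω u')).toReal
  set b := (eLpNorm G 2 (volume.restrict Ω)).toReal
  have henergy : N' ^ 2 + 2 * κ * ε * b ^ 2 ≤ N ^ 2 + 2 * κ * (K * volume.real Ω) := by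
    linarith [mul_le_mul_of_nonneg_left hpotential (by positivity : 0 ≤ 2 * κ)]
  calc N' ^ 2 * (γ ^ 2 + ε * κ)
      ≤ γ ^ 2 * N' ^ 2 + 2 * (ε * κ * N' ^ 2) := by
        linarith [(by positivity : 0 ≤ ε * κ * N' ^ 2)]
    _ ≤ γ ^ 2 * N' ^ 2 + 2 * (ε * κ * (γ ^ 2 * b ^ 2)) := by gcongr
    _ = γ ^ 2 * (N' ^ 2 + 2 * κ * ε * b ^ 2) := by ring
    _ ≤ _ := by gcongr

end Step

end BoundaryCondition

/-! ### Discrete Gronwall inequality and meshes -/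

theorem le_exp_neg_mul_add {a a' y B : ℝ} (hy : 0 ≤ y) (ha : 0 ≤ a) (hB : 0 ≤ B)
    (h : a' ≤ (1 - y) * (a + B * y)) :
    a' ≤ Real.exp (-y) * a + B * (1 - Real.exp (-y)) := by
  have hlower : 1 - y ≤ Real.exp (-y) := Real.one_sub_le_exp_neg y
  have hupper : Real.exp (-y) * (1 + y) ≤ 1 := by
    rw [Real.exp_neg, inv_mul_le_one₀ (Real.exp_pos y)]
    linarith [Real.add_one_le_exp y]
  have hquad : (1 - y) * y ≤ 1 - Real.exp (-y) := by
    refine le_of_mul_le_mul_right ?_ (by positivity : 0 < 1 + y)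
    linarith [pow_nonneg hy 3]
  calc a' ≤ (1 - y) * a + B * ((1 - y) * y) := h.trans_eq (by ring)
    _ ≤ _ := by gcongr

theorem discrete_gronwall {a τ : ℕ → ℝ} {B : ℝ} (hτ₀ : τ 0 = 0) (hτ : Monotone τ)
    (ha : ∀ n, 0 ≤ a n) (hB : 0 ≤ B)
    (h : ∀ n, a (n + 1) ≤ (1 - (τ (n + 1) - τ n)) * (a n + B * (τ (n + 1) - τ n))) (n : ℕ) :
    a n ≤ Real.exp (-τ n) * a 0 + B * (1 - Real.exp (-τ n)) := by
  induction n with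
  | zero => simp [hτ₀]
  | succ n ih =>
    set y := τ (n + 1) - τ n with hy
    have hexp : Real.exp (-τ (n + 1)) = Real.exp (-y) * Real.exp (-τ n) := by
      rw [← Real.exp_add, hy]
      ring_nf
    calc a (n + 1) ≤ Real.exp (-y) * a n + B * (1 - Real.exp (-y)) :=
          le_exp_neg_mul_add (sub_nonneg.2 (hτ n.le_succ)) (ha n) hB (h n)
      _ ≤ Real.exp (-y) * (Real.exp (-τ n) * a 0 + B * (1 - Real.exp (-τ n))) +
            B * (1 - Real.exp (-y)) := by gcongr
      _ = _ := by rw [hexp]; ring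

theorem le_one_sub_mul_of_mul_le {a a' γ ε κ k C : ℝ} (hγ : 0 < γ) (hε : 0 < ε) (hκ : 0 ≤ κ)
    (hκk : κ ≤ k) (ha : 0 ≤ a) (hC : 0 ≤ C)
    (h : a' * (γ ^ 2 + ε * κ) ≤ γ ^ 2 * (a + 2 * κ * C)) :
    a' ≤ (1 - ε * κ / (γ ^ 2 + ε * k)) *
      (a + 2 * C * ((γ ^ 2 + ε * k) / ε) * (ε * κ / (γ ^ 2 + ε * k))) := by
  have hk : 0 ≤ k := hκ.trans hκk
  calc a' ≤ γ ^ 2 * (a + 2 * κ * C) / (γ ^ 2 + ε * κ) := (le_div_iff₀ (by positivity)).2 h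
    _ = (1 - ε * κ / (γ ^ 2 + ε * κ)) * (a + 2 * κ * C) := by field_simp; ring
    _ ≤ (1 - ε * κ / (γ ^ 2 + ε * k)) * (a + 2 * κ * C) := by gcongr
    _ = _ := by field_simp

namespace IsMesh

variable {t : ℕ → ℝ} {k : ℝ}

theorem step_pos (h : IsMesh t k) (n : ℕ) : 0 < t (n + 1) - t n :=
  sub_pos.2 (h.strictMono n.lt_succ_self)

theorem step_le (h : IsMesh t k) (n : ℕ) : t (n + 1) - t n ≤ k :=
  h.isLUB.1 ⟨n, rfl⟩

theorem pos (h : IsMesh t k) : 0 < k :=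
  (h.step_pos 0).trans_le (h.step_le 0)

theorem exists_first_index (h : IsMesh t k) (T : ℝ) :
    ∃ n₀, 0 < n₀ ∧ (∀ i, 0 < i → T ≤ t i → n₀ ≤ i) ∧ ∀ n, n₀ ≤ n → T ≤ t n := by
  classical
  have hex : ∃ i, 0 < i ∧ T ≤ t i :=
    ((eventually_gt_atTop 0).and (h.tendsto.eventually_ge_atTop T)).exists
  exact ⟨Nat.find hex, (Nat.find_spec hex).1, fun i hi hTi => Nat.find_min' hex ⟨hi, hTi⟩,
    fun n hn => (Nat.find_spec hex).2.trans (h.strictMono.monotone hn)⟩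

end IsMesh

/-! ### The scheme -/

namespace BoundaryCondition.IsEulerSolution

variable {bc : BoundaryCondition} {Ω : Set (E d)} {γ ε α K k : ℝ} {f : ℝ → ℝ} {t : ℕ → ℝ}
  {u : ℕ → E d → ℝ}

theorem isEulerStep (hu : bc.IsEulerSolution Ω ε f t u) (n : ℕ) :
    bc.IsEulerStep Ω ε f (t (n + 1) - t n) (u n) (u (n + 1)) :=
  hu.2 n

theorem memLp (hu : bc.IsEulerSolution Ω ε f t u) : ∀ n, MemLp (u n) 2 (volume.restrict Ω)
  | 0 => hu.1
  | n + 1 => (hu.isEulerStep n).memLp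

variable [IsFiniteMeasure (volume.restrict Ω)]

theorem mean_eq (hu : bc.IsEulerSolution Ω ε f t u) (hΩ : bc.HasGradient Ω 1 0)
    (ht : IsMesh t k) (n : ℕ) : mean Ω (u n) = mean Ω (u 0) := by
  induction n with
  | zero => rfl
  | succ n ih => rw [(hu.isEulerStep n).mean_eq hΩ (ht.step_pos n).ne' (hu.memLp n), ih]

theorem negNorm_ne_top (hu : bc.IsEulerSolution Ω ε f t u) (hγ : bc.IsGamma Ω γ) (n : ℕ) :
    bc.negNorm Ω (fluct Ω (u n)) ≠ ⊤ :=
  hγ.negNorm_ne_top (memLp_fluct (hu.memLp n)) (integral_fluct (u n))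

theorem toReal_negNorm_sq_le (hu : bc.IsEulerSolution Ω ε f t u) (hΩ : bc.IsAdmissible Ω)
    (hγ : bc.IsGamma Ω γ) (hε : 0 < ε) (hf : IsDissipative f α K) (ht : IsMesh t k)
    (hm : |mean Ω (u 0)| ≤ α) (n : ℕ) :
    (bc.negNorm Ω (fluct Ω (u n))).toReal ^ 2 ≤
      Real.exp (-(ε * t n / (γ ^ 2 + ε * k))) * (bc.negNorm Ω (fluct Ω (u 0))).toReal ^ 2 +
        2 * (K * volume.real Ω) * ((γ ^ 2 + ε * k) / ε) *
          (1 - Real.exp (-(ε * t n / (γ ^ 2 + ε * k)))) := by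
  have hk := ht.pos
  have hK : 0 ≤ K := hf.nonneg ((abs_nonneg _).trans hm)
  refine discrete_gronwall (a := fun n => (bc.negNorm Ω (fluct Ω (u n))).toReal ^ 2)
    (τ := fun n => ε * t n / (γ ^ 2 + ε * k)) (by simp [ht.zero])
    ((ht.strictMono.monotone.const_mul hε.le).div_const (by positivity))
    (fun n => sq_nonneg _) (by positivity) (fun n => ?_) n
  rw [← sub_div, ← mul_sub]
  exact le_one_sub_mul_of_mul_le hγ.1 hε (ht.step_pos n).le (ht.step_le n) (sq_nonneg _)
    (by positivity) ((hu.isEulerStep n).negNorm_sq_mul_le hΩ hγ hε.le (ht.step_pos n) hf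
      (hu.memLp n) (by rwa [hu.mean_eq hΩ.hasGradient_one ht]))

theorem negNorm_sq_le (hu : bc.IsEulerSolution Ω ε f t u) (hΩ : bc.IsAdmissible Ω)
    (hγ : bc.IsGamma Ω γ) (hε : 0 < ε) (hf : IsDissipative f α K) (ht : IsMesh t k)
    (hm : |mean Ω (u 0)| ≤ α) (n : ℕ) :
    bc.negNorm Ω (fluct Ω (u n)) ^ 2 ≤
      ENNReal.ofReal (Real.exp (-(ε * t n / (γ ^ 2 + ε * k)))) *
          bc.negNorm Ω (fluct Ω (u 0)) ^ 2 +
        ENNReal.ofReal (2 * (K * volume.real Ω) * ((γ ^ 2 + ε * k) / ε) *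
          (1 - Real.exp (-(ε * t n / (γ ^ 2 + ε * k))))) := by
  rw [← ENNReal.ofReal_toReal (hu.negNorm_ne_top hγ n),
    ← ENNReal.ofReal_toReal (hu.negNorm_ne_top hγ 0), ← ENNReal.ofReal_pow ENNReal.toReal_nonneg,
    ← ENNReal.ofReal_pow ENNReal.toReal_nonneg, ← ENNReal.ofReal_mul (Real.exp_pos _).le]
  exact (ENNReal.ofReal_le_ofReal (hu.toReal_negNorm_sq_le hΩ hγ hε hf ht hm n)).trans
    ENNReal.ofReal_add_le

theorem negNorm_le_of_exp_le {R ρ : ℝ} (hu : bc.IsEulerSolution Ω ε f t u)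
    (hΩ : bc.IsAdmissible Ω) (hγ : bc.IsGamma Ω γ) (hε : 0 < ε) (hf : IsDissipative f α K)
    (ht : IsMesh t k) (hm : |mean Ω (u 0)| ≤ α)
    (hR : bc.negNorm Ω (fluct Ω (u 0)) ≤ ENNReal.ofReal R) (hρ : 0 ≤ ρ) {n : ℕ}
    (hn : Real.exp (-(ε * t n / (γ ^ 2 + ε * k))) * R ^ 2 +
      2 * (K * volume.real Ω) * ((γ ^ 2 + ε * k) / ε) ≤ ρ ^ 2) :
    bc.negNorm Ω (fluct Ω (u n)) ≤ ENNReal.ofReal ρ := by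
  have hk := ht.pos
  have hK : 0 ≤ K := hf.nonneg ((abs_nonneg _).trans hm)
  have hR_sq : (bc.negNorm Ω (fluct Ω (u 0))).toReal ^ 2 ≤ R ^ 2 := by
    rw [← sq_abs R]
    exact pow_le_pow_left₀ ENNReal.toReal_nonneg (ENNReal.toReal_le_of_le_ofReal (abs_nonneg R)
      (hR.trans (ENNReal.ofReal_le_ofReal (le_abs_self R)))) 2
  rw [ENNReal.le_ofReal_iff_toReal_le (hu.negNorm_ne_top hγ n) hρ]
  refine le_of_sq_le_sq ?_ hρ
  refine (hu.toReal_negNorm_sq_le hΩ hγ hε hf ht hm n).trans (le_trans ?_ hn)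
  exact add_le_add (mul_le_mul_of_nonneg_left hR_sq (Real.exp_pos _).le)
    (mul_le_of_le_one_right (by positivity) (sub_le_self _ (Real.exp_pos _).le))

end BoundaryCondition.IsEulerSolution

theorem exists_forall_exp_mul_add_le {ε D B ρ : ℝ} (hε : 0 < ε) (hD : 0 < D) (h : √B < ρ)
    (R : ℝ) : ∃ T, ∀ s, T ≤ s → Real.exp (-(ε * s / D)) * R ^ 2 + B ≤ ρ ^ 2 := by
  have hlim : Tendsto (fun s : ℝ => Real.exp (-(ε * s / D)) * R ^ 2 + B) atTop
      (𝓝 (0 * R ^ 2 + B)) :=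
    ((Real.tendsto_exp_neg_atTop_nhds_zero.comp
      ((tendsto_id.const_mul_atTop hε).atTop_div_const hD)).mul_const _).add_const _
  rw [zero_mul, zero_add] at hlim
  exact eventually_atTop.1 (hlim.eventually_le_const
    ((Real.sqrt_lt' ((Real.sqrt_nonneg B).trans_lt h)).1 h))

end CahnHilliard

end

theorem lemma4p2_general {d : ℕ} {bc : CahnHilliard.BoundaryCondition}
    {Ω : Set (CahnHilliard.E d)} (hΩ : bc.IsAdmissible Ω)
    (hPoincare : CahnHilliard.PoincareOn Ω Ω) :
    (∃ γ₁ : ℝ, bc.IsGamma Ω γ₁) ∧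
    ∀ γ₁ : ℝ, bc.IsGamma Ω γ₁ →
    ∀ ε : ℝ, 0 < ε →
    ∀ (f : ℝ → ℝ) (α K : ℝ), CahnHilliard.IsDissipative f α K →
    ∀ k : ℝ,
      (∀ t : ℕ → ℝ, CahnHilliard.IsMesh t k →
        ∀ u : ℕ → CahnHilliard.E d → ℝ, bc.IsEulerSolution Ω ε f t u →
          |CahnHilliard.mean Ω (u 0)| ≤ α →
          bc.negNorm Ω (CahnHilliard.fluct Ω (u 0)) ≠ ⊤ ∧
          ∀ n : ℕ,
            bc.negNorm Ω (CahnHilliard.fluct Ω (u (n + 1))) ^ 2 ≤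
              ENNReal.ofReal (Real.exp (-(ε * t (n + 1) / (γ₁ ^ 2 + ε * k)))) *
                  bc.negNorm Ω (CahnHilliard.fluct Ω (u 0)) ^ 2 +
                ENNReal.ofReal (2 * (K * volume.real Ω) * ((γ₁ ^ 2 + ε * k) / ε) *
                  (1 - Real.exp (-(ε * t (n + 1) / (γ₁ ^ 2 + ε * k)))))) ∧
      (∀ R ρ : ℝ,
        Real.sqrt (2 * (K * volume.real Ω) * ((γ₁ ^ 2 + ε * k) / ε)) < ρ →
        ∃ T : ℝ, ∀ t : ℕ → ℝ, CahnHilliard.IsMesh t k →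
          ∃ n₀ : ℕ, 0 < n₀ ∧ (∀ i : ℕ, 0 < i → T ≤ t i → n₀ ≤ i) ∧
            ∀ u : ℕ → CahnHilliard.E d → ℝ, bc.IsEulerSolution Ω ε f t u →
              |CahnHilliard.mean Ω (u 0)| ≤ α →
              bc.negNorm Ω (CahnHilliard.fluct Ω (u 0)) ≤ ENNReal.ofReal R →
              ∀ n : ℕ, n₀ ≤ n →
                bc.negNorm Ω (CahnHilliard.fluct Ω (u n)) ≤ ENNReal.ofReal ρ) := by
  have : IsFiniteMeasure (volume.restrict Ω) :=
    isFiniteMeasure_restrict.2 hΩ.isBounded.measure_lt_top.ne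
  refine ⟨bc.exists_isGamma hPoincare, fun γ hγ ε hε f α K hf k => ⟨?_, fun R ρ hρ => ?_⟩⟩
  · intro t ht u hu hm
    exact ⟨hu.negNorm_ne_top hγ 0, fun n => hu.negNorm_sq_le hΩ hγ hε hf ht hm (n + 1)⟩
  rcases le_or_gt k 0 with hk | hk
  · exact ⟨0, fun t ht => absurd ht.pos hk.not_gt⟩
  have hD : 0 < γ ^ 2 + ε * k := add_pos_of_nonneg_of_pos (sq_nonneg γ) (mul_pos hε hk)
  obtain ⟨T, hT⟩ := CahnHilliard.exists_forall_exp_mul_add_le hε hD hρ R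
  refine ⟨T, fun t ht => ?_⟩
  obtain ⟨n₀, hn₀, hfirst, hlate⟩ := ht.exists_first_index T
  exact ⟨n₀, hn₀, hfirst, fun u hu hm hR n hn =>
    hu.negNorm_le_of_exp_le hΩ hγ hε hf ht hm hR ((Real.sqrt_nonneg _).trans hρ.le)
      (hT _ (hlate n hn))⟩

theorem lemma4p2 {d : ℕ} (hd : 1 ≤ d) (hd3 : d ≤ 3)
    (bc : CahnHilliard.BoundaryCondition) (Ω : Set (CahnHilliard.E d)) (hΩ : bc.IsDomain Ω) :
    (∃ γ₁ : ℝ, bc.IsGamma Ω γ₁) ∧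
    ∀ γ₁ : ℝ, bc.IsGamma Ω γ₁ →
    ∀ ε : ℝ, 0 < ε →
    ∀ (f F : ℝ → ℝ) (p c₀ c₁ : ℝ) (c₂ : ℝ → ℝ) (c₃ : ℝ),
      CahnHilliard.Nonlinearity d f F p c₀ c₁ c₂ c₃ →
    ∀ α k : ℝ,
      (∀ t : ℕ → ℝ, CahnHilliard.IsMesh t k →
        ∀ u : ℕ → CahnHilliard.E d → ℝ, bc.IsEulerSolution Ω ε f t u →
          |CahnHilliard.mean Ω (u 0)| ≤ α →
          bc.negNorm Ω (CahnHilliard.fluct Ω (u 0)) ≠ ⊤ ∧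
          ∀ n : ℕ,
            bc.negNorm Ω (CahnHilliard.fluct Ω (u (n + 1))) ^ 2 ≤
              ENNReal.ofReal (Real.exp (-(ε * t (n + 1) / (γ₁ ^ 2 + ε * k)))) *
                  bc.negNorm Ω (CahnHilliard.fluct Ω (u 0)) ^ 2 +
                ENNReal.ofReal (2 * CahnHilliard.C1 Ω p c₁ c₂ c₃ α * ((γ₁ ^ 2 + ε * k) / ε) *
                  (1 - Real.exp (-(ε * t (n + 1) / (γ₁ ^ 2 + ε * k)))))) ∧
      (∀ R ρ : ℝ,
        Real.sqrt (2 * CahnHilliard.C1 Ω p c₁ c₂ c₃ α * ((γ₁ ^ 2 + ε * k) / ε)) < ρ →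
        ∃ T : ℝ, ∀ t : ℕ → ℝ, CahnHilliard.IsMesh t k →
          ∃ n₀ : ℕ, 0 < n₀ ∧ (∀ i : ℕ, 0 < i → T ≤ t i → n₀ ≤ i) ∧
            ∀ u : ℕ → CahnHilliard.E d → ℝ, bc.IsEulerSolution Ω ε f t u →
              |CahnHilliard.mean Ω (u 0)| ≤ α →
              bc.negNorm Ω (CahnHilliard.fluct Ω (u 0)) ≤ ENNReal.ofReal R →
              ∀ n : ℕ, n₀ ≤ n →
                bc.negNorm Ω (CahnHilliard.fluct Ω (u n)) ≤ ENNReal.ofReal ρ) := by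
  obtain ⟨hγ, h⟩ := lemma4p2_general hΩ.isAdmissible hΩ.poincareOn
  exact ⟨hγ, fun γ₁ hγ₁ ε hε f F p c₀ c₁ c₂ c₃ hf α => h γ₁ hγ₁ ε hε f α _ (hf.isDissipative α)⟩
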